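/- Let $p,q\in\mathbb{C}$ with $|p|<1$ and $q\neq 0$. For $u\in\mathbb{C}\setminus\{0\}$ put $$\theta(u;p)=\prod_{i\ge 0}(1-up^i)\Bigl(1-\frac{p}{u}p^{i}\Bigr),\qquad (u;q,p)_k=\prod_{i=0}^{k-1}\theta(uq^i;p)\quad(k\in\mathbb{Z}_{\ge0}),$$ and $(u_1,\dots,u_t;q,p)_k=(u_1;q,p)_k\cdots(u_t;q,p)_k$. Let $n,m\ge 1$ and $N\ge 0$ be integers, let $a,b,c,d,g,h$, $x_1,\dots,x_n$, $e_1,\dots,e_n$, $y_1,\dots,y_m$, $f_1,\dots,f_m$ be nonzero complex numbers, and put $E=e_1\cdots e_n$, $F=f_1\cdots f_m$, $\lambda=qa^2/bcd$. For tuples of non-negative integers write $|\mathbf{k}|=k_1+\dots+k_n$ and $|\mathbf{j}|=j_1+\dots+j_m$. If none of the denominators in the following formula vanishes, then $$ \begin{aligned} &\sum_{\substack{k_1,\dots,k_n\ge 0\\ 0\le|\mathbf{k}|\le N}}\Biggl(\prod_{1\le r<s\le n}\frac{\theta(q^{k_r-k_s}x_r/x_s;p)}{\theta(x_r/x_s;p)}\prod_{r,s=1}^n\frac{(e_sx_r/x_s;q,p)_{k_r}}{(qx_r/x_s;q,p)_{k_r}}\cdot\frac{\theta(aq^{2|\mathbf{k}|};p)}{\theta(a;p)}\\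 &\quad\times\frac{(a,b,c,d;q,p)_{|\mathbf{k}|}}{(aq^{N+1},aq/b,aq/c,aq/d;q,p)_{|\mathbf{k}|}}\cdot\frac{(F,\ \lambda aq^{1+N}/EF,\ q^{-N};q,p)_{|\mathbf{k}|}}{(aq/E,\ aq/F,\ EFq^{-N}/\lambda;q,p)_{|\mathbf{k}|}}\\ &\quad\times\prod_{r=1}^n\frac{(gx_r/E;q,p)_{k_r}\,(gx_r;q,p)_{|\mathbf{k}|}}{(gx_r;q,p)_{k_r}\,(gx_r/e_r;q,p)_{|\mathbf{k}|}}\cdot q^{\sum_{r=1}^n rk_r}\Biggr)\\ &=\frac{(aq,\ aq/EF,\ \lambda q/E,\ \lambda q/F;q,p)_N}{(aq/E,\ aq/F,\ \lambda q,\ \lambda q/EF;q,p)_N}\\ &\quad\times\sum_{\substack{j_1,\dots,j_m\ge 0\\ 0\le|\mathbf{j}|\le N}}\Biggl(\prod_{1\le r<s\le m}\frac{\theta(q^{j_r-j_s}y_r/y_s;p)}{\theta(y_r/y_s;p)}\prod_{r,s=1}^m\frac{(f_sy_r/y_s;q,p)_{j_r}}{(qy_r/y_s;q,p)_{j_r}}\cdot\frac{\theta(\lambda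 q^{2|\mathbf{j}|};p)}{\theta(\lambda;p)}\\ &\quad\times\frac{(\lambda,\lambda b/a,\lambda c/a,\lambda d/a;q,p)_{|\mathbf{j}|}}{(\lambda q^{N+1},aq/b,aq/c,aq/d;q,p)_{|\mathbf{j}|}}\cdot\frac{(E,\ \lambda aq^{1+N}/EF,\ q^{-N};q,p)_{|\mathbf{j}|}}{(\lambda q/E,\ \lambda q/F,\ EFq^{-N}/a;q,p)_{|\mathbf{j}|}}\\ &\quad\times\prod_{r=1}^m\frac{(hy_r/F;q,p)_{j_r}\,(hy_r;q,p)_{|\mathbf{j}|}}{(hy_r;q,p)_{j_r}\,(hy_r/f_r;q,p)_{|\mathbf{j}|}}\cdot q^{\sum_{r=1}^m rj_r}\Biggr). \end{aligned} $$ -/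

import Mathlib

open Finset

namespace EllipticSeries

/-- The infinite shifted factorial `(a; p)_∞ = ∏_{j ≥ 0} (1 - a p^j)`, used for `|p| < 1`. -/
noncomputable def qInf (a p : ℂ) : ℂ := ∏' j : ℕ, (1 - a * p ^ j)

/-- For `|p| < 1` the product that defines `(a; p)_∞` converges. -/
theorem multipliable_qInf {p : ℂ} (hp : ‖p‖ < 1) (a : ℂ) :
    Multipliable fun j : ℕ => 1 - a * p ^ j := by
  have hs : Summable fun j : ℕ => ‖-(a * p ^ j)‖ := by
    have h := (summable_geometric_of_lt_one (norm_nonneg p) hp).mul_left ‖a‖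
    simpa [norm_mul, norm_pow] using h
  simpa [sub_eq_add_neg] using multipliable_one_add_of_summable hs

/-- The modified Jacobi theta function `θ(a; p) = (a; p)_∞ (p/a; p)_∞`
(for `a ≠ 0` and `|p| < 1`). -/
noncomputable def theta (a p : ℂ) : ℂ := qInf a p * qInf (p / a) p

/-- For nome zero, `θ(a; 0) = 1 - a`. -/
theorem theta_zero (a : ℂ) : theta a 0 = 1 - a := by
  have h : ∀ b : ℂ, qInf b 0 = 1 - b := by
    intro b
    unfold qInf
    rw [tprod_eq_mulSingle 0]
    · simp
    · intro j hj
      simp [hj]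
  simp [theta, h]

/-- The theta shifted factorial `(a; q, p)_k = ∏_{j=0}^{k-1} θ(a q^j; p)`. -/
noncomputable def thetaPoch (q p a : ℂ) (k : ℕ) : ℂ :=
  ∏ j ∈ range k, theta (a * q ^ j) p

/-- The shorthand `(a₁, …, a_t; q, p)_k = (a₁; q, p)_k ⋯ (a_t; q, p)_k`. -/
noncomputable def thetaPochs (q p : ℂ) (l : List ℂ) (k : ℕ) : ℂ :=
  (l.map fun a => thetaPoch q p a k).prod

/-- The elliptic Vandermonde product of type `A`,
`∏_{r < s} θ(q^{k_r - k_s} x_r / x_s; p) / θ(x_r / x_s; p)`. -/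
noncomputable def vandermonde (q p : ℂ) {n : ℕ} (x : Fin n → ℂ) (k : Fin n → ℕ) : ℂ :=
  ∏ r : Fin n, ∏ s ∈ Ioi r,
    theta (q ^ ((k r : ℤ) - (k s : ℤ)) * (x r / x s)) p / theta (x r / x s) p

/-- The `n`-tuples `k` of non-negative integers with `k₁ + ⋯ + k_n ≤ N`. -/
def simplex (n N : ℕ) : Finset (Fin n → ℕ) :=
  (Fintype.piFinset fun _ : Fin n => range (N + 1)).filter fun k => ∑ r, k r ≤ N

theorem mem_simplex {n N : ℕ} {k : Fin n → ℕ} : k ∈ simplex n N ↔ ∑ r, k r ≤ N := by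
  simp only [simplex, mem_filter, Fintype.mem_piFinset, mem_range, and_iff_right_iff_imp]
  intro h r
  exact Nat.lt_succ_of_le ((single_le_sum (fun i _ => Nat.zero_le (k i)) (mem_univ r)).trans h)

end EllipticSeries

/-!
The idea is that all dependence on the dimension disappears once the terms of fixed total degree are
summed. For fixed `|k| = K` the sum of the type `A` part of the terms is `q^K (E)_K / (q)_K`, whatever
`n`, `x` and `g` are (`IsTheta.sum_kernelTerm`, `sum_simplex_kernel`). Hence both sides of the
identity are series in one variable, and what remains is the elliptic Bailey transformation between
two `₁₂V₁₁` series of Frenkel and Turaev (`IsTheta.wpSeries_transformation`).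

The type `A` summation is proved by induction on `K`. The factor that leads from degree `K` to degree
`K + 1` is expanded in partial fractions at the points `x_r q^{k_r}`, and after regrouping the
contributions to each term of degree `K + 1` add up by a second partial fraction expansion. The
partial fractions themselves (`IsTheta.partial_fraction`) follow by induction on the number of points
from Weierstrass' addition formula.

The case `n = 2` of the type `A` summation is the Frenkel–Turaev summation
(`IsTheta.frenkel_turaev`). Bailey's argument, which applies this summation twice to a double sum and
exchanges the order of summation, gives the transformation for generic parameters. Both sides are
continuous in the parameters and the zeros of the theta function are countable, so the remaining
parameters are reached by a limit.

Nothing but a few properties of the theta function enters, and these are collected in `IsTheta`. The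
addition formula is derived from the Jacobi triple product: the product of two theta series, split by
the parity of the sum of the indices, shows that `θ(xy) θ(x/y) / x` is an alternating form of rank two
in `x` and `y`, and the addition formula is the Plücker relation for this form.
-/

namespace EllipticSeries

open Filter Topology

/-! ### The Jacobi triple product -/

/-- The term `(-1)^k p^{k(k-1)/2} x^k` of the bilateral series for the theta function. -/
noncomputable def thetaTerm (p x : ℂ) (k : ℤ) : ℂ := (-1) ^ k * p ^ (k * (k - 1) / 2) * x ^ k

theorem mul_pred_half_succ (k : ℤ) : (k + 1) * (k + 1 - 1) / 2 = k * (k - 1) / 2 + k := by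
  have : (k + 1) * (k + 1 - 1) = k * (k - 1) + k * 2 := by ring
  rw [this, Int.add_mul_ediv_right _ _ (by norm_num)]

theorem thetaTerm_succ {p x : ℂ} (hp : p ≠ 0) (hx : x ≠ 0) (k : ℤ) :
    thetaTerm p x (k + 1) = -(p ^ k * x) * thetaTerm p x k := by
  unfold thetaTerm
  rw [mul_pred_half_succ, zpow_add₀ hp, zpow_add_one₀ hx, zpow_add_one₀ (by norm_num)]
  ring

theorem thetaTerm_ne_zero {p x : ℂ} (hp : p ≠ 0) (hx : x ≠ 0) (k : ℤ) : thetaTerm p x k ≠ 0 :=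
  mul_ne_zero (mul_ne_zero (zpow_ne_zero _ (by norm_num)) (zpow_ne_zero _ hp)) (zpow_ne_zero _ hx)

theorem summable_thetaTerm {p x : ℂ} (hp : p ≠ 0) (hp1 : ‖p‖ < 1) (hx : x ≠ 0) :
    Summable fun k => ‖thetaTerm p x k‖ := by
  have h0 := tendsto_pow_atTop_nhds_zero_of_lt_one (norm_nonneg p) hp1
  apply Summable.of_nat_of_neg
  · apply summable_of_ratio_test_tendsto_lt_one (l := 0) one_pos
    · exact .of_forall fun n => norm_ne_zero_iff.2 (thetaTerm_ne_zero hp hx _)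
    · have h := h0.mul_const ‖x‖
      rw [zero_mul] at h
      refine h.congr fun n => ?_
      have h1 : ‖thetaTerm p x n‖ ≠ 0 := norm_ne_zero_iff.2 (thetaTerm_ne_zero hp hx _)
      rw [Nat.cast_succ, thetaTerm_succ hp hx]
      simp only [norm_mul, norm_neg, norm_norm, zpow_natCast, norm_pow]
      field_simp
  · apply summable_of_ratio_test_tendsto_lt_one (l := 0) one_pos
    · exact .of_forall fun n => norm_ne_zero_iff.2 (thetaTerm_ne_zero hp hx _)
    · have h := (h0.mul_const (‖p‖ * ‖x‖⁻¹))
      rw [zero_mul] at h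
      refine h.congr fun n => ?_
      have h1 : ‖thetaTerm p x (-((n + 1 : ℕ) : ℤ))‖ ≠ 0 :=
        norm_ne_zero_iff.2 (thetaTerm_ne_zero hp hx _)
      have h2 := thetaTerm_succ hp hx (-((n + 1 : ℕ) : ℤ))
      have h3 : (-((n + 1 : ℕ) : ℤ)) + 1 = -(n : ℤ) := by push_cast; ring
      rw [h3] at h2
      rw [h2]
      have h4 : p ^ (-((n + 1 : ℕ) : ℤ)) = (p ^ (n + 1))⁻¹ := by rw [zpow_neg, zpow_natCast]
      rw [h4]
      simp only [norm_mul, norm_neg, norm_norm, norm_inv, norm_pow]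
      have hp' := norm_ne_zero_iff.2 hp
      have hx' := norm_ne_zero_iff.2 hx
      field_simp
      ring

/-- The reciprocal `1 / (p; p)_j`, read as zero when `j` is negative. -/
noncomputable def invEuler (p : ℂ) (j : ℤ) : ℂ :=
  if 0 ≤ j then (∏ i ∈ range j.toNat, (1 - p ^ (i + 1)))⁻¹ else 0

theorem one_sub_pow_ne_zero {p : ℂ} (hp1 : ‖p‖ < 1) (i : ℕ) : 1 - p ^ (i + 1) ≠ 0 := by
  intro h
  have h1 : ‖p ^ (i + 1)‖ = 1 := by rw [← sub_eq_zero.1 h]; simp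
  rw [norm_pow] at h1
  exact absurd h1 (pow_lt_one₀ (norm_nonneg p) hp1 (by omega)).ne

/-- The recurrence holds for negative `j` too, which spares the boundary cases of the finite triple
product. -/
theorem invEuler_eq {p : ℂ} (hp1 : ‖p‖ < 1) (j : ℤ) :
    invEuler p j = (1 - p ^ (j + 1)) * invEuler p (j + 1) := by
  unfold invEuler
  rcases lt_trichotomy j (-1) with h | rfl | h
  · rw [if_neg (by omega), if_neg (by omega), mul_zero]
  · simp
  · obtain ⟨n, rfl⟩ := Int.eq_ofNat_of_zero_le (show 0 ≤ j by omega)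
    rw [if_pos (by omega), if_pos (by omega), show ((n : ℤ) + 1).toNat = n + 1 by omega,
      prod_range_succ, Int.toNat_natCast, mul_inv, show (n : ℤ) + 1 = ((n + 1 : ℕ) : ℤ) by simp,
      zpow_natCast]
    have := one_sub_pow_ne_zero hp1 n
    field_simp

/-- The finite form of the triple product: `(p; p)_{2n} / ((p; p)_{n+k} (p; p)_{n-k})` is the
Gaussian binomial coefficient. -/
theorem hasSum_finite_triple_product {p x : ℂ} (hp : p ≠ 0) (hp1 : ‖p‖ < 1) (hx : x ≠ 0) (n : ℕ) :
    HasSum (fun k : ℤ => thetaTerm p x k *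
      ((∏ i ∈ range (2 * n), (1 - p ^ (i + 1))) * invEuler p (n + k) * invEuler p (n - k)))
      (∏ i ∈ range n, ((1 - x * p ^ i) * (1 - p / x * p ^ i))) := by
  induction n with
  | zero =>
    have h := hasSum_single (f := fun k : ℤ => thetaTerm p x k *
      ((∏ i ∈ range (2 * 0), (1 - p ^ (i + 1))) * invEuler p ((0 : ℕ) + k)
        * invEuler p ((0 : ℕ) - k))) 0 (by
        intro k hk
        rcases lt_or_gt_of_ne hk with h | h
        · have : invEuler p ((0 : ℕ) + k) = 0 := if_neg (by simpa using h)
          rw [this]; simp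
        · have : invEuler p ((0 : ℕ) - k) = 0 := if_neg (by simpa using h)
          rw [this]; simp)
    simpa [thetaTerm, invEuler] using h
  | succ n ih =>
    have hd := (Equiv.addRight (-1 : ℤ)).hasSum_iff.2 ih
    have hu := (Equiv.addRight (1 : ℤ)).hasSum_iff.2 ih
    have h := ((ih.mul_left (1 + p ^ (2 * n + 1))).add (hd.mul_left (-(x * p ^ n)))).add
      (hu.mul_left (-(p ^ (n + 1) / x)))
    refine (congrArg₂ (fun f a => HasSum f a) ?_ ?_).mpr h
    · funext k
      simp only [Function.comp_apply, Equiv.coe_addRight]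
      have e1 := thetaTerm_succ hp hx k
      have e2 := thetaTerm_succ hp hx (k + -1)
      rw [neg_add_cancel_right] at e2
      have u1 := invEuler_eq hp1 (n + k)
      have u2 := invEuler_eq hp1 (n + k - 1)
      have v1 := invEuler_eq hp1 (n - k)
      have v2 := invEuler_eq hp1 (n - k - 1)
      rw [sub_add_cancel] at u2 v2
      rw [show ((n : ℤ) + (k + -1)) = n + k - 1 by ring, show ((n : ℤ) - (k + -1)) = n - k + 1 by ring,
        show ((n : ℤ) + (k + 1)) = n + k + 1 by ring, show ((n : ℤ) - (k + 1)) = n - k - 1 by ring,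
        show ((n + 1 : ℕ) : ℤ) + k = n + k + 1 by push_cast; ring,
        show ((n + 1 : ℕ) : ℤ) - k = n - k + 1 by push_cast; ring,
        show 2 * (n + 1) = 2 * n + 1 + 1 by ring, prod_range_succ, prod_range_succ, u2, v2, u1, v1,
        e1, e2]
      generalize thetaTerm p x (k + -1) = T
      generalize invEuler p (n + k + 1) = U
      generalize invEuler p (n - k + 1) = V
      generalize ∏ i ∈ range (2 * n), (1 - p ^ (i + 1)) = Q
      have a1 : p ^ ((n : ℤ) + k + 1) = p ^ n * p ^ k * p := by
        rw [zpow_add_one₀ hp, zpow_add₀ hp, zpow_natCast]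
      have a2 : p ^ ((n : ℤ) + k) = p ^ n * p ^ k := by rw [zpow_add₀ hp, zpow_natCast]
      have a3 : p ^ ((n : ℤ) - k + 1) = p ^ n * (p ^ k)⁻¹ * p := by
        rw [zpow_add_one₀ hp, zpow_sub₀ hp, zpow_natCast, div_eq_mul_inv]
      have a4 : p ^ ((n : ℤ) - k) = p ^ n * (p ^ k)⁻¹ := by
        rw [zpow_sub₀ hp, zpow_natCast, div_eq_mul_inv]
      have a5 : p ^ (k + -1) = p ^ k * p⁻¹ := by rw [zpow_add₀ hp, zpow_neg_one]
      rw [a1, a2, a3, a4, a5]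
      have hk : p ^ k ≠ 0 := zpow_ne_zero _ hp
      generalize p ^ k = A at *
      rw [show p ^ (2 * n + 1) = p ^ n * p ^ n * p by ring,
        show p ^ (2 * n + 1 + 1) = p ^ n * p ^ n * p * p by ring, show p ^ (n + 1) = p ^ n * p by ring]
      generalize p ^ n = B
      field_simp
      ring
    · rw [prod_range_succ]
      rw [show p ^ (2 * n + 1) = p ^ n * p ^ n * p by ring, pow_succ, mul_div_assoc]
      have h' : x * (p / x) = p := mul_div_cancel₀ _ hx
      linear_combination (∏ i ∈ range n, ((1 - x * p ^ i) * (1 - p / x * p ^ i))) * p ^ n * p ^ n * h'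

theorem qInf_tendsto {p : ℂ} (hp1 : ‖p‖ < 1) (a : ℂ) :
    Tendsto (fun n => ∏ i ∈ range n, (1 - a * p ^ i)) atTop (𝓝 (qInf a p)) :=
  (multipliable_qInf hp1 a).hasProd.tendsto_prod_nat

theorem qInf_ne_zero {p : ℂ} (hp1 : ‖p‖ < 1) {a : ℂ} (h : ∀ j : ℕ, a * p ^ j ≠ 1) :
    qInf a p ≠ 0 := by
  have hs : Summable fun j : ℕ => ‖-(a * p ^ j)‖ := by
    have h := (summable_geometric_of_lt_one (norm_nonneg p) hp1).mul_left ‖a‖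
    simpa [norm_mul, norm_pow] using h
  have := tprod_one_add_ne_zero_of_summable (f := fun j : ℕ => -(a * p ^ j)) (fun i h0 => h i (by
    linear_combination -h0)) hs
  simpa [qInf, sub_eq_add_neg] using this

/-- The Jacobi triple product, in the form used below: up to a constant, which is `1 / (p; p)_∞`, the
theta function is the sum of its bilateral series. -/
theorem exists_theta_eq_tsum {p : ℂ} (hp : p ≠ 0) (hp1 : ‖p‖ < 1) :
    ∃ C : ℂ, ∀ x : ℂ, x ≠ 0 → theta x p = C * ∑' k, thetaTerm p x k := by
  have hP : Tendsto (fun n => ∏ i ∈ range n, (1 - p ^ (i + 1))) atTop (𝓝 (qInf p p)) := by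
    simpa only [pow_succ'] using qInf_tendsto hp1 p
  have hP0 : qInf p p ≠ 0 := qInf_ne_zero hp1 fun j h =>
    one_sub_pow_ne_zero hp1 j (by rw [pow_succ', h, sub_self])
  obtain ⟨B, hB⟩ := (hP.norm.bddAbove_range)
  have hB' : ∀ n, ‖∏ i ∈ range n, (1 - p ^ (i + 1))‖ ≤ B := fun n => hB ⟨n, rfl⟩
  obtain ⟨D, hD⟩ := ((hP.inv₀ hP0).norm.bddAbove_range)
  have hD' : ∀ n, ‖(∏ i ∈ range n, (1 - p ^ (i + 1)))⁻¹‖ ≤ D := fun n => hD ⟨n, rfl⟩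
  have hD0 : 0 ≤ D := (norm_nonneg _).trans (hD' 0)
  have hB0 : 0 ≤ B := (norm_nonneg _).trans (hB' 0)
  have hu : ∀ j, ‖invEuler p j‖ ≤ D := by
    intro j
    unfold invEuler
    split_ifs
    · exact hD' _
    · simpa using hD0
  have hul : Tendsto (fun n : ℕ => invEuler p n) atTop (𝓝 (qInf p p)⁻¹) := by
    simpa [invEuler] using hP.inv₀ hP0
  have hul' : Tendsto (fun j : ℤ => invEuler p j) atTop (𝓝 (qInf p p)⁻¹) := by
    rw [← Nat.map_cast_int_atTop]
    exact hul
  refine ⟨(qInf p p)⁻¹, fun x hx => ?_⟩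
  -- pass to the limit in the finite form, by dominated convergence
  have h1 : Tendsto (fun n => ∏ i ∈ range n, ((1 - x * p ^ i) * (1 - p / x * p ^ i))) atTop
      (𝓝 (theta x p)) := by
    simp only [prod_mul_distrib]
    exact (qInf_tendsto hp1 x).mul (qInf_tendsto hp1 (p / x))
  have h2 : Tendsto (fun n : ℕ => ∑' k : ℤ, thetaTerm p x k *
      ((∏ i ∈ range (2 * n), (1 - p ^ (i + 1))) * invEuler p (n + k) * invEuler p (n - k))) atTop
      (𝓝 (∑' k : ℤ, thetaTerm p x k * (qInf p p * (qInf p p)⁻¹ * (qInf p p)⁻¹))) := by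
    apply tendsto_tsum_of_dominated_convergence
      (bound := fun k => ‖thetaTerm p x k‖ * (B * D * D))
    · exact (summable_thetaTerm hp hp1 hx).mul_right _
    · intro k
      have t0 : Tendsto (fun n : ℕ => (n : ℤ)) atTop atTop := tendsto_natCast_atTop_atTop
      refine Tendsto.const_mul _ (((hP.comp ?_).mul (hul'.comp ?_)).mul (hul'.comp ?_))
      · exact tendsto_atTop_mono (fun n => by simp only [id]; omega) tendsto_id
      · exact tendsto_atTop_add_const_right _ _ t0
      · exact tendsto_atTop_add_const_right _ _ t0
    · refine .of_forall fun n k => ?_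
      rw [norm_mul, norm_mul, norm_mul]
      gcongr
      · exact hB' _
      · exact hu _
      · exact hu _
  have h3 : ∀ n : ℕ, ∑' k : ℤ, thetaTerm p x k *
      ((∏ i ∈ range (2 * n), (1 - p ^ (i + 1))) * invEuler p (n + k) * invEuler p (n - k))
      = ∏ i ∈ range n, ((1 - x * p ^ i) * (1 - p / x * p ^ i)) := fun n =>
    (hasSum_finite_triple_product hp hp1 hx n).tsum_eq
  simp only [h3] at h2
  rw [tendsto_nhds_unique h1 h2, tsum_mul_right, mul_inv_cancel₀ hP0]
  ring

/-! ### Properties of the theta function -/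

/-- Pairs of integers of equal and of different parity, parametrized by half-sums and
half-differences. -/
def parityEquiv : (ℤ × ℤ) ⊕ (ℤ × ℤ) ≃ ℤ × ℤ where
  toFun := Sum.elim (fun z => (z.1 + z.2, z.1 - z.2)) (fun z => (z.1 + z.2 + 1, z.1 - z.2))
  invFun z := if (z.1 + z.2) % 2 = 0 then .inl ((z.1 + z.2) / 2, (z.1 - z.2) / 2)
    else .inr ((z.1 + z.2 - 1) / 2, (z.1 - z.2 - 1) / 2)
  left_inv := by
    rintro (⟨s, t⟩ | ⟨s, t⟩)
    · change (if (s + t + (s - t)) % 2 = 0 then _ else _ : (ℤ × ℤ) ⊕ (ℤ × ℤ)) = _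
      rw [if_pos (by omega)]
      simp only [Sum.elim_inl]
      congr 2 <;> omega
    · change (if (s + t + 1 + (s - t)) % 2 = 0 then _ else _ : (ℤ × ℤ) ⊕ (ℤ × ℤ)) = _
      rw [if_neg (by omega)]
      simp only [Sum.elim_inr]
      congr 2 <;> omega
  right_inv := by
    rintro ⟨k, l⟩
    dsimp only
    split_ifs with h
    · simp only [Sum.elim_inl, Prod.mk.injEq]
      omega
    · simp only [Sum.elim_inr, Prod.mk.injEq]
      omega

theorem two_mul_half (k : ℤ) : 2 * (k * (k - 1) / 2) = k * (k - 1) :=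
  Int.mul_ediv_cancel' (Int.even_mul_pred_self k).two_dvd

/-- With both indices of the product of two series replaced by half-sum and half-difference, the
variables separate. The corresponding fact for indices of different parity is
`thetaTerm_mul_odd`. -/
theorem thetaTerm_mul_even {p x y : ℂ} (hp : p ≠ 0) (hx : x ≠ 0) (hy : y ≠ 0) (s t : ℤ) :
    thetaTerm p (x * y) (s + t) * thetaTerm p (x / y) (s - t) =
      thetaTerm (p ^ 2) (-x ^ 2) s * thetaTerm (p ^ 2) (-(p * y ^ 2)) t := by
  unfold thetaTerm
  have h1 : ∀ k : ℤ, (p ^ 2) ^ (k * (k - 1) / 2) = p ^ (k * (k - 1)) := fun k => by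
    conv_rhs => rw [← two_mul_half k, zpow_mul, zpow_ofNat]
  have h2 : (s + t) * (s + t - 1) / 2 + (s - t) * (s - t - 1) / 2
      = s * (s - 1) + t * (t - 1) + t := by
    have a := two_mul_half (s + t)
    have b := two_mul_half (s - t)
    linarith [show (s + t) * (s + t - 1) + (s - t) * (s - t - 1)
      = 2 * (s * (s - 1) + t * (t - 1) + t) by ring]
  have h3 : p ^ ((s + t) * (s + t - 1) / 2) * p ^ ((s - t) * (s - t - 1) / 2)
      = p ^ (s * (s - 1)) * p ^ (t * (t - 1)) * p ^ t := by
    rw [← zpow_add₀ hp, h2, zpow_add₀ hp, zpow_add₀ hp]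
  have m1 : (-1 : ℂ) ≠ 0 := by norm_num
  have h4 : (-1 : ℂ) ^ (s + t) * (-1 : ℂ) ^ (s - t) = 1 := by
    rw [← zpow_add₀ m1, show s + t + (s - t) = 2 * s by ring, zpow_mul]; simp
  have h5 : (x * y) ^ (s + t) * (x / y) ^ (s - t) = (x ^ 2) ^ s * (y ^ 2) ^ t := by
    rw [zpow_add₀ (mul_ne_zero hx hy), zpow_sub₀ (div_ne_zero hx hy), mul_zpow, mul_zpow, div_zpow,
      div_zpow, ← zpow_natCast x 2, ← zpow_natCast y 2, zpow_comm x, zpow_comm y, zpow_natCast,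
      zpow_natCast]
    have := zpow_ne_zero s hx
    have := zpow_ne_zero t hx
    have := zpow_ne_zero s hy
    have := zpow_ne_zero t hy
    field_simp
  have h6 : ∀ (k : ℤ) (z : ℂ), (-z) ^ k = (-1) ^ k * z ^ k := fun k z => by
    rw [← mul_zpow, neg_one_mul]
  have h7 : ∀ k : ℤ, (-1 : ℂ) ^ k * (-1) ^ k = 1 := fun k => by rw [← mul_zpow]; simp
  rw [h1, h1, h6 s (x ^ 2), h6 t (p * y ^ 2), mul_zpow p]
  calc _ = ((-1 : ℂ) ^ (s + t) * (-1 : ℂ) ^ (s - t)) *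
        (p ^ ((s + t) * (s + t - 1) / 2) * p ^ ((s - t) * (s - t - 1) / 2)) *
        ((x * y) ^ (s + t) * (x / y) ^ (s - t)) := by ring
    _ = ((-1) ^ s * (-1 : ℂ) ^ s) * ((-1) ^ t * (-1 : ℂ) ^ t) *
        (p ^ (s * (s - 1)) * p ^ (t * (t - 1)) * p ^ t) * ((x ^ 2) ^ s * (y ^ 2) ^ t) := by
      rw [h3, h4, h5, h7, h7]; ring
    _ = _ := by ring

theorem thetaTerm_mul_odd {p x y : ℂ} (hp : p ≠ 0) (hx : x ≠ 0) (hy : y ≠ 0) (s t : ℤ) :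
    thetaTerm p (x * y) (s + t + 1) * thetaTerm p (x / y) (s - t) =
      -(x * y) * (thetaTerm (p ^ 2) (-(p * x ^ 2)) s * thetaTerm (p ^ 2) (-(p ^ 2 * y ^ 2)) t) := by
  have hc : ∀ z : ℂ, thetaTerm (p ^ 2) (p * z) s = p ^ s * thetaTerm (p ^ 2) z s := fun z => by
    unfold thetaTerm; rw [mul_zpow]; ring
  have hd : ∀ z : ℂ, thetaTerm (p ^ 2) (p * z) t = p ^ t * thetaTerm (p ^ 2) z t := fun z => by
    unfold thetaTerm; rw [mul_zpow]; ring
  rw [thetaTerm_succ hp (mul_ne_zero hx hy), mul_assoc, thetaTerm_mul_even hp hx hy,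
    show -(p * x ^ 2) = p * (-x ^ 2) by ring, show -(p ^ 2 * y ^ 2) = p * (-(p * y ^ 2)) by ring,
    hc, hd, zpow_add₀ hp]
  ring

/-- The products `θ(xy) θ(x/y)` are, up to the factor `x`, values of an alternating form of rank
two. Weierstrass' addition formula is the Plücker relation for this form. -/
theorem exists_theta_mul_theta_eq {p : ℂ} (hp1 : ‖p‖ < 1) :
    ∃ F G : ℂ → ℂ, ∀ x y : ℂ, x ≠ 0 → y ≠ 0 →
      theta (x * y) p * theta (x / y) p = x * (F x * G y - G x * F y) := by
  by_cases hp : p = 0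
  · subst hp
    refine ⟨fun x => -(x + x⁻¹), fun _ => -1, fun x y hx hy => ?_⟩
    rw [theta_zero, theta_zero]
    field_simp
    ring
  obtain ⟨C, hC⟩ := exists_theta_eq_tsum hp hp1
  have hp2 : p ^ 2 ≠ 0 := pow_ne_zero _ hp
  have hp3 : ‖p ^ 2‖ < 1 := by rw [norm_pow]; exact pow_lt_one₀ (norm_nonneg p) hp1 two_ne_zero
  refine ⟨fun x => C * C * (x * ∑' k, thetaTerm (p ^ 2) (-(p ^ 2 * x ^ 2)) k),
    fun x => ∑' k, thetaTerm (p ^ 2) (-(p * x ^ 2)) k, fun x y hx hy => ?_⟩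
  have hxy := mul_ne_zero hx hy
  have hxy' := div_ne_zero hx hy
  have s1 := summable_thetaTerm hp hp1 hxy
  have s2 := summable_thetaTerm hp hp1 hxy'
  have ev : ∀ z w : ℂ, z ≠ 0 → w ≠ 0 → HasSum (fun i : ℤ × ℤ =>
      thetaTerm (p ^ 2) z i.1 * thetaTerm (p ^ 2) w i.2)
      ((∑' k, thetaTerm (p ^ 2) z k) * ∑' k, thetaTerm (p ^ 2) w k) := fun z w hz hw => by
    have a := summable_thetaTerm hp2 hp3 hz
    have b := summable_thetaTerm hp2 hp3 hw
    rw [tsum_mul_tsum_of_summable_norm a b]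
    exact (summable_mul_of_summable_norm a b).hasSum
  have hs : HasSum (fun i : ℤ × ℤ => thetaTerm p (x * y) i.1 * thetaTerm p (x / y) i.2)
      ((∑' k, thetaTerm p (x * y) k) * ∑' k, thetaTerm p (x / y) k) := by
    rw [tsum_mul_tsum_of_summable_norm s1 s2]
    exact (summable_mul_of_summable_norm s1 s2).hasSum
  have n1 : -x ^ 2 ≠ 0 := neg_ne_zero.2 (pow_ne_zero _ hx)
  have n2 : ∀ z : ℂ, z ≠ 0 → -(p * z ^ 2) ≠ 0 := fun z hz =>
    neg_ne_zero.2 (mul_ne_zero hp (pow_ne_zero _ hz))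
  have n3 : -(p ^ 2 * y ^ 2) ≠ 0 := neg_ne_zero.2 (mul_ne_zero hp2 (pow_ne_zero _ hy))
  have hs' := parityEquiv.hasSum_iff.2 hs
  have key := hs'.unique (HasSum.sum
    (f := (fun i : ℤ × ℤ => thetaTerm p (x * y) i.1 * thetaTerm p (x / y) i.2) ∘ parityEquiv)
    (((ev (-x ^ 2) (-(p * y ^ 2)) n1 (n2 y hy)).congr_fun ?_))
    (((ev (-(p * x ^ 2)) (-(p ^ 2 * y ^ 2)) (n2 x hx) n3).mul_left (-(x * y))).congr_fun ?_))
  rotate_left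
  · intro i; exact thetaTerm_mul_even hp hx hy i.1 i.2
  · intro i; exact thetaTerm_mul_odd hp hx hy i.1 i.2
  -- this shift of the index gives both parity classes the same pair of functions
  have shift : ∑' k, thetaTerm (p ^ 2) (-x ^ 2) k
      = x ^ 2 * ∑' k, thetaTerm (p ^ 2) (-(p ^ 2 * x ^ 2)) k := by
    rw [← (Equiv.addRight (1 : ℤ)).tsum_eq, ← tsum_mul_left]
    congr 1
    funext k
    rw [Equiv.coe_addRight, thetaTerm_succ hp2 n1]
    unfold thetaTerm
    rw [show -(p ^ 2 * x ^ 2) = p ^ 2 * -x ^ 2 by ring, mul_zpow]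
    ring
  rw [shift] at key
  rw [hC _ hxy, hC _ hxy']
  linear_combination C * C * key

/-- The properties of a multiplicative theta function on which the elliptic identities rest: it
vanishes at `1`, it satisfies the inversion formula and Weierstrass' addition formula, it is
continuous on the punctured plane, and its zeros are countable. -/
structure IsTheta (θ : ℂ → ℂ) : Prop where
  one : θ 1 = 0
  inv : ∀ u, u ≠ 0 → θ u⁻¹ = -u⁻¹ * θ u
  addition : ∀ x y u v, x ≠ 0 → y ≠ 0 → u ≠ 0 → v ≠ 0 →
    θ (x * y) * θ (x / y) * (θ (u * v) * θ (u / v)) - θ (x * v) * θ (x / v) * (θ (u * y) * θ (u / y))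
      = u / y * (θ (y * v) * θ (y / v) * (θ (x * u) * θ (x / u)))
  continuousAt : ∀ u, u ≠ 0 → ContinuousAt θ u
  countable_zeros : {u | θ u = 0}.Countable

theorem qInf_eq_one_sub_mul {p : ℂ} (hp1 : ‖p‖ < 1) (a : ℂ) :
    qInf a p = (1 - a) * qInf (a * p) p := by
  have h1 := (tendsto_add_atTop_iff_nat 1).2 (qInf_tendsto hp1 a)
  have h2 := (qInf_tendsto hp1 (a * p)).const_mul (1 - a)
  refine tendsto_nhds_unique h1 (h2.congr fun n => ?_)
  rw [prod_range_succ', mul_comm]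
  congr 1
  · exact prod_congr rfl fun i _ => by ring
  · simp

theorem continuous_qInf {p : ℂ} (hp1 : ‖p‖ < 1) : Continuous fun a => qInf a p := by
  rw [continuous_iff_continuousAt]
  intro a
  have hs := (summable_geometric_of_lt_one (norm_nonneg p) hp1).mul_left (‖a‖ + 1)
  have hK : IsOpen (Metric.ball (0 : ℂ) (‖a‖ + 1)) := Metric.isOpen_ball
  have h := Summable.multipliableLocallyUniformlyOn_nat_one_add (f := fun (j : ℕ) (a : ℂ) => -(a * p ^ j))
    hK hs (.of_forall fun j x hx => by
      rw [norm_neg, norm_mul, norm_pow]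
      have := (mem_ball_zero_iff.1 hx).le
      gcongr) (fun j => by fun_prop)
  have h2 := h.hasProdLocallyUniformlyOn.tendstoLocallyUniformlyOn_finsetRange
  have h3 := h2.continuousOn (.of_forall fun n => by fun_prop)
  have h4 := h3.continuousAt (hK.mem_nhds (show a ∈ Metric.ball (0 : ℂ) (‖a‖ + 1) by simp))
  simpa [qInf, sub_eq_add_neg] using h4

theorem isTheta_theta {p : ℂ} (hp1 : ‖p‖ < 1) : IsTheta fun u => theta u p where
  one := by simp [theta, qInf_eq_one_sub_mul hp1 1]
  inv u hu := by
    simp only [theta]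
    rw [qInf_eq_one_sub_mul hp1 u, qInf_eq_one_sub_mul hp1 u⁻¹, div_inv_eq_mul, mul_comm p u,
      div_eq_inv_mul p u]
    field_simp
    ring
  addition x y u v hx hy hu hv := by
    obtain ⟨F, G, h⟩ := exists_theta_mul_theta_eq hp1
    rw [h x y hx hy, h u v hu hv, h x v hx hv, h u y hu hy, h y v hy hv, h x u hx hu]
    field_simp
    ring
  continuousAt u hu := by
    have h1 : ContinuousAt (fun u : ℂ => p / u) u := continuousAt_const.div continuousAt_id hu
    exact (continuous_qInf hp1).continuousAt.mul
      (ContinuousAt.comp (g := fun a => qInf a p) (continuous_qInf hp1).continuousAt h1)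
  countable_zeros := by
    refine ((Set.countable_range fun j : ℕ => (p ^ j)⁻¹).union
      (Set.countable_range fun j : ℕ => p * p ^ j)).union (Set.countable_singleton (0 : ℂ)) |>.mono ?_
    intro u hu
    by_contra hn
    simp only [Set.mem_union, Set.mem_range, Set.mem_singleton_iff, not_or, not_exists] at hn
    obtain ⟨⟨h1, h2⟩, h0⟩ := hn
    refine mul_ne_zero (qInf_ne_zero hp1 fun j hj => h1 j (eq_inv_of_mul_eq_one_left hj).symm)
      (qInf_ne_zero hp1 fun j hj => h2 j ?_) hu
    field_simp at hj
    exact hj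

/-- Two functions that are continuous at `1` and agree off a countable set agree at `1`. -/
theorem eq_at_one_of_eq_off_countable {f g : ℂ → ℂ} {S : Set ℂ} (hS : S.Countable)
    (hf : ContinuousAt f 1) (hg : ContinuousAt g 1) (h : ∀ t, t ∉ S → f t = g t) : f 1 = g 1 := by
  have hd : (1 : ℂ) ∈ closure Sᶜ := hS.dense_compl ℂ 1
  have : (𝓝[Sᶜ] (1 : ℂ)).NeBot := mem_closure_iff_nhdsWithin_neBot.1 hd
  refine tendsto_nhds_unique (l := 𝓝[Sᶜ] (1 : ℂ)) (hf.mono_left nhdsWithin_le_nhds)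
    ((hg.mono_left nhdsWithin_le_nhds).congr' ?_)
  filter_upwards [self_mem_nhdsWithin] with t ht
  exact (h t ht).symm

namespace IsTheta

variable {θ : ℂ → ℂ}

theorem div_comm (hθ : IsTheta θ) {a b : ℂ} (ha : a ≠ 0) (hb : b ≠ 0) :
    θ (a / b) = -(a / b) * θ (b / a) := by
  rw [← inv_div b a, hθ.inv _ (div_ne_zero hb ha)]

theorem countable_setOf_mul (hθ : IsTheta θ) {c : ℂ} (hc : c ≠ 0) :
    {t | θ (t * c) = 0}.Countable :=
  hθ.countable_zeros.preimage (mul_left_injective₀ hc)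

theorem continuousAt_comp (hθ : IsTheta θ) {f : ℂ → ℂ} {t : ℂ} (hf : ContinuousAt f t)
    (h0 : f t ≠ 0) : ContinuousAt (fun t => θ (f t)) t :=
  ContinuousAt.comp (g := θ) (hθ.continuousAt _ h0) hf

/-! ### Partial fractions of type `A` -/

/-- The addition formula in the shape needed for partial fractions: the square roots that relate
it to the symmetric shape are eliminated. -/
theorem addition_div (hθ : IsTheta θ) {G a b w e : ℂ} (hG : G ≠ 0) (ha : a ≠ 0) (hb : b ≠ 0)
    (hw : w ≠ 0) (he : e ≠ 0) :
    θ (w * e) * θ (a / b) * (θ (G * a / w) * θ (G * b / e)) =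
      θ w * θ (e * a / b) * (θ (G * b) * θ (G * a / (w * e))) +
      w * θ e * θ (a / (b * w)) * (θ (G * a) * θ (G * b / (w * e))) := by
  obtain ⟨s, hs⟩ := IsAlgClosed.exists_pow_nat_eq (a / b) (n := 2) two_pos
  obtain ⟨y, rfl⟩ := IsAlgClosed.exists_pow_nat_eq w (n := 2) two_pos
  obtain ⟨z, rfl⟩ := IsAlgClosed.exists_pow_nat_eq e (n := 2) two_pos
  obtain rfl : a = b * s ^ 2 := by rw [hs]; field_simp
  have hs0 : s ≠ 0 := by rintro rfl; simp at ha
  have hy0 : y ≠ 0 := by rintro rfl; simp at hw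
  have hz0 : z ≠ 0 := by rintro rfl; simp at he
  have h := hθ.addition (G * b * s / (y * z)) (s * z / y) (s * y * z) (y * z / s)
    (by positivity) (by positivity) (by positivity) (by positivity)
  have e1 : G * b * s / (y * z) * (s * z / y) = G * (b * s ^ 2) / y ^ 2 := by field_simp
  have e2 : G * b * s / (y * z) / (s * z / y) = G * b / z ^ 2 := by field_simp
  have e3 : s * y * z * (y * z / s) = y ^ 2 * z ^ 2 := by field_simp
  have e4 : s * y * z / (y * z / s) = b * s ^ 2 / b := by field_simp
  have e5 : G * b * s / (y * z) * (y * z / s) = G * b := by field_simp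
  have e6 : G * b * s / (y * z) / (y * z / s) = G * (b * s ^ 2) / (y ^ 2 * z ^ 2) := by field_simp
  have e7 : s * y * z * (s * z / y) = z ^ 2 * (b * s ^ 2) / b := by field_simp
  have e8 : s * y * z / (s * z / y) = y ^ 2 := by field_simp
  have e9 : s * z / y * (y * z / s) = z ^ 2 := by field_simp
  have e10 : s * z / y / (y * z / s) = b * s ^ 2 / (b * y ^ 2) := by field_simp
  have e11 : G * b * s / (y * z) * (s * y * z) = G * (b * s ^ 2) := by field_simp
  have e12 : G * b * s / (y * z) / (s * y * z) = G * b / (y ^ 2 * z ^ 2) := by field_simp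
  rw [e1, e2, e3, e4, e5, e6, e7, e8, e9, e10, e11, e12] at h
  linear_combination h

/-- The partial fraction expansion of type `A`, with the denominators that involve `G` cleared. -/
theorem partial_fraction (hθ : IsTheta θ) {ι : Type*} [DecidableEq ι] (s : Finset ι) (X : ι → ℂ)
    (hX : ∀ i, X i ≠ 0) (hs : ∀ i ∈ s, ∀ j ∈ s, i ≠ j → θ (X i / X j) ≠ 0) :
    ∀ (e : ι → ℂ), (∀ i, e i ≠ 0) → ∀ G : ℂ, G ≠ 0 →
    ∑ r ∈ s, (∏ i ∈ s, θ (e i * X r / X i)) * θ (G * X r / ∏ i ∈ s, e i) *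
        ∏ i ∈ s.erase r, (θ (G * X i) / θ (X r / X i)) =
      θ (∏ i ∈ s, e i) * ∏ i ∈ s, θ (G * X i / e i) := by
  induction s using Finset.induction_on with
  | empty => intro e he G hG; simp [hθ.one]
  | insert n s hn ih =>
    have hs' : ∀ i ∈ s, ∀ j ∈ s, i ≠ j → θ (X i / X j) ≠ 0 := fun i hi j hj =>
      hs i (mem_insert_of_mem hi) j (mem_insert_of_mem hj)
    have hsn : ∀ i ∈ s, θ (X i / X n) ≠ 0 := fun i hi =>
      hs i (mem_insert_of_mem hi) n (mem_insert_self _ _) (by rintro rfl; exact hn hi)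
    have hns : ∀ i ∈ s, θ (X n / X i) ≠ 0 := fun i hi =>
      hs n (mem_insert_self _ _) i (mem_insert_of_mem hi) (by rintro rfl; exact hn hi)
    replace ih := ih hs'
    -- the induction step, as long as `θ (∏ i ∈ s, e i)` can be cancelled
    have step : ∀ (e : ι → ℂ), (∀ i, e i ≠ 0) → θ (∏ i ∈ s, e i) ≠ 0 → ∀ G : ℂ, G ≠ 0 →
        ∑ r ∈ insert n s, (∏ i ∈ insert n s, θ (e i * X r / X i)) *
            θ (G * X r / ∏ i ∈ insert n s, e i) *
            ∏ i ∈ (insert n s).erase r, (θ (G * X i) / θ (X r / X i)) =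
          θ (∏ i ∈ insert n s, e i) * ∏ i ∈ insert n s, θ (G * X i / e i) := by
      intro e he hE G hG
      apply mul_left_cancel₀ hE
      have hw : ∏ i ∈ s, e i ≠ 0 := prod_ne_zero_iff.2 fun i _ => he i
      have ih1 := ih e he G hG
      have ih2 := ih e he (X n)⁻¹ (inv_ne_zero (hX n))
      rw [sum_insert hn, prod_insert hn, prod_insert hn, prod_insert hn, erase_insert hn,
        mul_comm (e n) (∏ i ∈ s, e i)]
      generalize hwdef : ∏ i ∈ s, e i = w at *
      -- the expansion of the factor with index `n`
      have ex : ∀ r ∈ s, θ (w * e n) * θ (G * X n / e n) *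
          ((∏ i ∈ s, θ (e i * X r / X i)) * θ (G * X r / w) *
            ∏ i ∈ s.erase r, (θ (G * X i) / θ (X r / X i))) =
          θ w * ((∏ i ∈ insert n s, θ (e i * X r / X i)) * θ (G * X r / (w * e n)) *
            ∏ i ∈ (insert n s).erase r, (θ (G * X i) / θ (X r / X i))) +
          w * θ (e n) * θ (G * X n / (w * e n)) * (∏ i ∈ s, θ (G * X i) / θ (X i / X n)) *
          ((∏ i ∈ s, θ (e i * X r / X i)) * θ ((X n)⁻¹ * X r / w) *
            ∏ i ∈ s.erase r, (θ ((X n)⁻¹ * X i) / θ (X r / X i))) := by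
        intro r hr
        have hrn : n ≠ r := by rintro rfl; exact hn hr
        have hn' : n ∉ s.erase r := fun h => hn (mem_of_mem_erase h)
        have ad := hθ.addition_div hG (hX r) (hX n) hw (he n)
        rw [prod_insert hn, erase_insert_of_ne hrn, prod_insert hn',
          ← mul_prod_erase s (fun i => θ (G * X i) / θ (X i / X n)) hr]
        have h1 : θ (X r / X n) ≠ 0 := hsn r hr
        have h2 : (∏ i ∈ s.erase r, θ (G * X i) / θ (X i / X n)) *
            ∏ i ∈ s.erase r, (θ ((X n)⁻¹ * X i) / θ (X r / X i))
            = ∏ i ∈ s.erase r, (θ (G * X i) / θ (X r / X i)) := by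
          rw [← prod_mul_distrib]
          refine prod_congr rfl fun i hi => ?_
          have := hsn i (mem_of_mem_erase hi)
          rw [inv_mul_eq_div]
          field_simp
        have h3 : (X n)⁻¹ * X r / w = X r / (X n * w) := by
          rw [inv_mul_eq_div, div_div]
        rw [h3]
        calc _ = (θ (w * e n) * θ (X r / X n) * (θ (G * X r / w) * θ (G * X n / e n))) / θ (X r / X n)
              * (∏ i ∈ s, θ (e i * X r / X i)) *
              ∏ i ∈ s.erase r, (θ (G * X i) / θ (X r / X i)) := by
              have aux : ∀ A B C D Q R : ℂ, B ≠ 0 →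
                  A * D * (Q * C * R) = A * B * (C * D) / B * Q * R := fun A B C D Q R hB => by
                field_simp
              exact aux _ _ _ _ _ _ h1
          _ = _ := by
            rw [ad, ← h2]
            field_simp
      have ex2 : w * ((∏ i ∈ s, θ (G * X i) / θ (X i / X n)) *
          ∏ i ∈ s, θ ((X n)⁻¹ * X i / e i)) =
          (∏ i ∈ s, θ (e i * X n / X i)) * ∏ i ∈ s, (θ (G * X i) / θ (X n / X i)) := by
        rw [← hwdef, ← prod_mul_distrib, ← prod_mul_distrib, ← prod_mul_distrib]
        refine prod_congr rfl fun i hi => ?_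
        have a1 := hsn i hi
        have a2 := hns i hi
        have b1 := hθ.div_comm (hX i) (mul_ne_zero (he i) (hX n))
        have b2 := hθ.div_comm (hX i) (hX n)
        rw [b2] at a1 ⊢
        rw [show (X n)⁻¹ * X i / e i = X i / (e i * X n) by rw [inv_mul_eq_div, div_div, mul_comm],
          b1]
        have := hX i; have := hX n; have := he i
        field_simp
      have hsum := sum_congr rfl ex
      rw [← mul_sum, ih1, sum_add_distrib, ← mul_sum, ← mul_sum, ih2] at hsum
      have hnn : e n * X n / X n = e n := by rw [mul_div_assoc, div_self (hX n), mul_one]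
      rw [hnn]
      linear_combination (-1 : ℂ) * hsum - θ w * θ (e n) * θ (G * X n / (w * e n)) * ex2
    intro e he G hG
    rcases s.eq_empty_or_nonempty with rfl | ⟨m, hm⟩
    · simp [hX n]
    -- in general, perturb one of the `e i`
    let u : ℂ → ι → ℂ := fun t i => if i = m then t * e i else e i
    have hu1 : u 1 = e := by funext i; simp [u]
    have hu0 : ∀ t i, t ≠ 0 → u t i ≠ 0 := fun t i ht => by
      simp only [u]; split_ifs
      · exact mul_ne_zero ht (he i)
      · exact he i
    have hprod : ∀ t, ∏ i ∈ s, u t i = t * ∏ i ∈ s, e i := fun t => by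
      rw [← mul_prod_erase s _ hm, ← mul_prod_erase s e hm, ← mul_assoc]
      congr 1
      · simp [u]
      · exact prod_congr rfl fun i hi => by simp [u, ne_of_mem_erase hi]
    have hw : ∏ i ∈ s, e i ≠ 0 := prod_ne_zero_iff.2 fun i _ => he i
    have hc : ∀ i, ContinuousAt (fun t => u t i) 1 := fun i => by
      simp only [u]; split_ifs <;> fun_prop
    have hcp : ContinuousAt (fun t => ∏ i ∈ insert n s, u t i) 1 :=
      tendsto_finsetProd _ fun i _ => hc i
    have hp1 : ∏ i ∈ insert n s, u 1 i ≠ 0 := prod_ne_zero_iff.2 fun i _ => hu0 1 i one_ne_zero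
    have key := eq_at_one_of_eq_off_countable
      (f := fun t => ∑ r ∈ insert n s, (∏ i ∈ insert n s, θ (u t i * X r / X i)) *
        θ (G * X r / ∏ i ∈ insert n s, u t i) *
        ∏ i ∈ (insert n s).erase r, (θ (G * X i) / θ (X r / X i)))
      (g := fun t => θ (∏ i ∈ insert n s, u t i) * ∏ i ∈ insert n s, θ (G * X i / u t i))
      ((hθ.countable_setOf_mul hw).union (Set.countable_singleton 0)) ?_ ?_ ?_
    · simpa only [hu1] using key
    · refine tendsto_finsetSum _ fun r _ => Tendsto.mul_const _ (Tendsto.mul ?_ ?_)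
      · refine tendsto_finsetProd _ fun i _ => hθ.continuousAt_comp ?_ ?_
        · exact ((hc i).mul_const _).div_const _
        · exact div_ne_zero (mul_ne_zero (hu0 1 i one_ne_zero) (hX r)) (hX i)
      · exact hθ.continuousAt_comp (continuousAt_const.div hcp hp1)
          (div_ne_zero (mul_ne_zero hG (hX r)) hp1)
    · refine Tendsto.mul (hθ.continuousAt_comp hcp hp1) (tendsto_finsetProd _ fun i _ => ?_)
      exact hθ.continuousAt_comp (continuousAt_const.div (hc i) (hu0 1 i one_ne_zero))
        (div_ne_zero (mul_ne_zero hG (hX i)) (hu0 1 i one_ne_zero))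
    · intro t ht
      simp only [Set.mem_union, Set.mem_ofPred_eq, Set.mem_singleton_iff, not_or] at ht
      refine step (u t) (fun i => hu0 t i ht.2) ?_ G hG
      rw [hprod]
      exact ht.1

end IsTheta

/-! ### Theta shifted factorials and the type `A` summation of fixed degree -/

/-- The theta shifted factorial `∏_{j < k} θ(a q^j)` of an arbitrary function `θ`. -/
noncomputable def sf (θ : ℂ → ℂ) (q a : ℂ) (k : ℕ) : ℂ := ∏ j ∈ range k, θ (a * q ^ j)

theorem sf_zero (θ : ℂ → ℂ) (q a : ℂ) : sf θ q a 0 = 1 := by simp [sf]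

theorem sf_succ (θ : ℂ → ℂ) (q a : ℂ) (k : ℕ) : sf θ q a (k + 1) = sf θ q a k * θ (a * q ^ k) :=
  prod_range_succ _ _

theorem sf_ne_zero {θ : ℂ → ℂ} {q a : ℂ} {k : ℕ} : sf θ q a k ≠ 0 ↔ ∀ j < k, θ (a * q ^ j) ≠ 0 := by
  simp [sf, prod_ne_zero_iff]

theorem sf_ne_zero_of_le {θ : ℂ → ℂ} {q a : ℂ} {k N : ℕ} (h : sf θ q a N ≠ 0) (hk : k ≤ N) :
    sf θ q a k ≠ 0 :=
  sf_ne_zero.2 fun j hj => sf_ne_zero.1 h j (hj.trans_le hk)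

/-- The part of a term of the multiple series that depends on `k` through more than its total degree;
here `e 0 * ⋯ * e (n - 1)` takes the place of `E`. The coordinates are numbered from `0`, hence the
exponent `r + 1`. -/
noncomputable def kernelTerm (θ : ℂ → ℂ) (q : ℂ) {n : ℕ} (x e : Fin n → ℂ) (g : ℂ)
    (k : Fin n → ℕ) : ℂ :=
  (∏ r, ∏ s ∈ Ioi r, θ (q ^ ((k r : ℤ) - (k s : ℤ)) * (x r / x s)) / θ (x r / x s))
    * (∏ r, ∏ s, sf θ q (e s * (x r / x s)) (k r) / sf θ q (q * (x r / x s)) (k r))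
    * (∏ r, sf θ q (g * x r / ∏ i, e i) (k r) / sf θ q (g * x r) (k r))
    * q ^ (∑ r : Fin n, ((r : ℕ) + 1) * k r)

/-- How a product over the coordinates of `k` changes when one coordinate is raised by one. -/
theorem prod_succ_at {ι : Type*} [Fintype ι] [DecidableEq ι] (f : ι → ℕ → ℂ) (k : ι → ℕ) (r : ι)
    {c : ℂ} (h : f r (k r + 1) = f r (k r) * c) :
    ∏ i, f i ((k + Pi.single r 1 : ι → ℕ) i) = (∏ i, f i (k i)) * c := by
  rw [← mul_prod_erase univ _ (mem_univ r), ← mul_prod_erase univ (fun i => f i (k i)) (mem_univ r),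
    Pi.add_apply, Pi.single_eq_same, h, mul_right_comm]
  congr 2
  refine prod_congr rfl fun i hi => ?_
  simp only [Pi.add_apply, Pi.single_eq_of_ne (ne_of_mem_erase hi), add_zero]

theorem prod_erase_eq_Ioi_mul_Iio {n : ℕ} (f : Fin n → ℂ) (r : Fin n) :
    ∏ i ∈ univ.erase r, f i = (∏ i ∈ Ioi r, f i) * ∏ i ∈ Iio r, f i := by
  rw [← prod_union (disjoint_left.2 fun i hi hj => lt_asymm (mem_Ioi.1 hi) (mem_Iio.1 hj))]
  congr 1
  ext i
  simp [lt_or_lt_iff_ne, eq_comm]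

/-- A product over ordered pairs, with the pairs that contain `r` split off. -/
theorem prod_pairs_eq {n : ℕ} (h : Fin n → Fin n → ℂ) (r : Fin n) :
    ∏ i, ∏ j ∈ Ioi i, h i j = (∏ j ∈ Ioi r, h r j) * (∏ i ∈ Iio r, h i r) *
      ∏ i ∈ univ.erase r, ∏ j ∈ (Ioi i).erase r, h i j := by
  rw [← mul_prod_erase univ _ (mem_univ r), mul_assoc]
  congr 1
  have : ∏ i ∈ Iio r, h i r = ∏ i ∈ univ.erase r, if i < r then h i r else 1 := by
    rw [← prod_filter]
    congr 1
    ext i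
    simp only [mem_Iio, mem_filter, mem_erase, mem_univ, and_true]
    exact ⟨fun h => ⟨h.ne, h⟩, fun h => h.2⟩
  rw [this, ← prod_mul_distrib]
  refine prod_congr rfl fun i _ => ?_
  split_ifs with hi
  · rw [mul_prod_erase (Ioi i) (fun j => h i j) (mem_Ioi.2 hi)]
  · rw [erase_eq_of_notMem (by simpa using hi), one_mul]

namespace IsTheta

variable {θ : ℂ → ℂ}

/-- The effect on the Vandermonde product of multiplying one variable by `q`. -/
theorem vandermonde_shift (hθ : IsTheta θ) {n : ℕ} {q : ℂ} (hq : q ≠ 0) {X X' : Fin n → ℂ}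
    (hX : ∀ i, X i ≠ 0) {r : Fin n} (hr : X' r = q * X r) (hs : ∀ s, s ≠ r → X' s = X s) :
    (∏ i, ∏ j ∈ Ioi i, θ (X' i / X' j)) * (∏ s ∈ univ.erase r, θ (X r / X s)) * q ^ (r : ℕ) =
      (∏ i, ∏ j ∈ Ioi i, θ (X i / X j)) * ∏ s ∈ univ.erase r, θ (q * X r / X s) := by
  rw [prod_pairs_eq _ r, prod_pairs_eq (fun i j => θ (X i / X j)) r,
    prod_erase_eq_Ioi_mul_Iio (fun s => θ (X r / X s)),
    prod_erase_eq_Ioi_mul_Iio (fun s => θ (q * X r / X s))]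
  have h1 : ∏ j ∈ Ioi r, θ (X' r / X' j) = ∏ j ∈ Ioi r, θ (q * X r / X j) :=
    prod_congr rfl fun j hj => by rw [hr, hs j (mem_Ioi.1 hj).ne']
  have h2 : ∏ i ∈ univ.erase r, ∏ j ∈ (Ioi i).erase r, θ (X' i / X' j)
      = ∏ i ∈ univ.erase r, ∏ j ∈ (Ioi i).erase r, θ (X i / X j) :=
    prod_congr rfl fun i hi => prod_congr rfl fun j hj => by
      rw [hs i (ne_of_mem_erase hi), hs j (ne_of_mem_erase hj)]
  have h3 : (∏ i ∈ Iio r, θ (X' i / X' r)) * (∏ i ∈ Iio r, θ (X r / X i)) * q ^ (r : ℕ) =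
      (∏ i ∈ Iio r, θ (X i / X r)) * ∏ i ∈ Iio r, θ (q * X r / X i) := by
    have : q ^ (r : ℕ) = ∏ i ∈ Iio r, q := by simp
    rw [this, ← prod_mul_distrib, ← prod_mul_distrib, ← prod_mul_distrib]
    refine prod_congr rfl fun i hi => ?_
    rw [hr, hs i (mem_Iio.1 hi).ne, hθ.div_comm (hX i) (mul_ne_zero hq (hX r)),
      hθ.div_comm (hX i) (hX r)]
    have := hX r
    field_simp
  rw [h1, h2]
  linear_combination (∏ j ∈ Ioi r, θ (q * X r / X j)) * (∏ j ∈ Ioi r, θ (X r / X j)) *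
    (∏ i ∈ univ.erase r, ∏ j ∈ (Ioi i).erase r, θ (X i / X j)) * h3

/-- The ratio of two neighbouring terms, in a form without division. -/
theorem kernelTerm_succ (hθ : IsTheta θ) {n : ℕ} {q : ℂ} (hq : q ≠ 0) {x e : Fin n → ℂ} {g : ℂ}
    (hx : ∀ i, x i ≠ 0) (k : Fin n → ℕ) (r : Fin n)
    (h1 : ∀ s, θ (q * (x r / x s) * q ^ k r) ≠ 0) (h2 : θ (g * x r * q ^ k r) ≠ 0) :
    kernelTerm θ q x e g (k + Pi.single r 1) *
      ((∏ s, θ (q * (x r / x s) * q ^ k r)) * θ (g * x r * q ^ k r) *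
        ∏ s ∈ univ.erase r, θ (x r * q ^ k r / (x s * q ^ k s))) =
    q * kernelTerm θ q x e g k *
      ((∏ s, θ (e s * (x r / x s) * q ^ k r)) * θ (g * x r / (∏ i, e i) * q ^ k r) *
        ∏ s ∈ univ.erase r, θ (q * (x r * q ^ k r) / (x s * q ^ k s))) := by
  have hV : ∀ k : Fin n → ℕ, ∏ r, ∏ s ∈ Ioi r,
      θ (q ^ ((k r : ℤ) - (k s : ℤ)) * (x r / x s)) / θ (x r / x s) =
      (∏ r, ∏ s ∈ Ioi r, θ (x r * q ^ k r / (x s * q ^ k s))) /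
        ∏ r, ∏ s ∈ Ioi r, θ (x r / x s) := fun k => by
    simp only [prod_div_distrib]
    congr 1
    refine prod_congr rfl fun r _ => prod_congr rfl fun s _ => ?_
    rw [zpow_sub₀ hq, zpow_natCast, zpow_natCast]
    congr 1
    have := hx s
    field_simp
  have a1 := prod_succ_at (fun r m => ∏ s, sf θ q (e s * (x r / x s)) m /
    sf θ q (q * (x r / x s)) m) k r
    (c := (∏ s, θ (e s * (x r / x s) * q ^ k r)) / ∏ s, θ (q * (x r / x s) * q ^ k r)) (by
      simp only [sf_succ, prod_div_distrib, prod_mul_distrib]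
      rw [mul_div_mul_comm])
  have a2 := prod_succ_at (fun r m => sf θ q (g * x r / ∏ i, e i) m / sf θ q (g * x r) m) k r
    (c := θ (g * x r / (∏ i, e i) * q ^ k r) / θ (g * x r * q ^ k r)) (by
      simp only [sf_succ]
      rw [mul_div_mul_comm])
  have a3 : q ^ (∑ i : Fin n, ((i : ℕ) + 1) * (k + Pi.single r 1 : Fin n → ℕ) i) =
      q ^ (∑ i : Fin n, ((i : ℕ) + 1) * k i) * q ^ ((r : ℕ) + 1) := by
    rw [← pow_add]
    congr 1
    simp [mul_add, sum_add_distrib, Pi.single_apply]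
  have a4 := hθ.vandermonde_shift hq (X := fun i => x i * q ^ k i)
    (X' := fun i => x i * q ^ ((k + Pi.single r 1 : Fin n → ℕ) i))
    (fun i => mul_ne_zero (hx i) (pow_ne_zero _ hq)) (r := r)
    (by simp only [Pi.add_apply, Pi.single_eq_same, pow_succ]; ring) (fun s hs => by simp [Pi.single_eq_of_ne hs])
  unfold kernelTerm
  rw [hV, hV, a1, a2, a3]
  have h1' : ∏ s, θ (q * (x r / x s) * q ^ k r) ≠ 0 := prod_ne_zero_iff.2 fun s _ => h1 s
  generalize ∏ s, θ (q * (x r / x s) * q ^ k r) = P1 at *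
  generalize ∏ s, θ (e s * (x r / x s) * q ^ k r) = P2 at *
  generalize θ (g * x r * q ^ k r) = P3 at *
  generalize θ (g * x r / (∏ i, e i) * q ^ k r) = P4 at *
  generalize ∏ s ∈ univ.erase r, θ (x r * q ^ k r / (x s * q ^ k s)) = P5 at *
  generalize ∏ s ∈ univ.erase r, θ (q * (x r * q ^ k r) / (x s * q ^ k s)) = P6 at *
  generalize ∏ i, ∏ s ∈ Ioi i, θ (x i * q ^ ((k + Pi.single r 1 : Fin n → ℕ) i) /
    (x s * q ^ ((k + Pi.single r 1 : Fin n → ℕ) s))) = V' at *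
  generalize ∏ i, ∏ s ∈ Ioi i, θ (x i * q ^ k i / (x s * q ^ k s)) = V at *
  generalize ∏ i, ∏ s ∈ Ioi i, θ (x i / x s) = W at *
  generalize (∏ r, ∏ s, sf θ q (e s * (x r / x s)) (k r) / sf θ q (q * (x r / x s)) (k r)) = A at *
  generalize (∏ r, sf θ q (g * x r / ∏ i, e i) (k r) / sf θ q (g * x r) (k r)) = B at *
  generalize q ^ (∑ i : Fin n, ((i : ℕ) + 1) * k i) = Q at *
  have e1 : V' / W * (A * (P2 / P1)) * (B * (P4 / P3)) * (Q * q ^ ((r : ℕ) + 1)) * (P1 * P3 * P5)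
      = (V' * P5 * q ^ (r : ℕ)) * q / W * A * P2 * B * P4 * Q * (P1 / P1) * (P3 / P3) := by ring
  rw [e1, a4, div_self h1', div_self h2]
  ring

/-- The partial fraction expansion at the points `x i * q ^ k i`, the exponents being absorbed into
the `e i`. -/
theorem partial_fraction_shift (hθ : IsTheta θ) {n : ℕ} {q : ℂ} (hq : q ≠ 0) {x e : Fin n → ℂ}
    {g : ℂ} (hg : g ≠ 0) (hx : ∀ i, x i ≠ 0) (he : ∀ i, e i ≠ 0) (k : Fin n → ℕ)
    (h : ∀ i j, i ≠ j → θ (x i * q ^ k i / (x j * q ^ k j)) ≠ 0) :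
    ∑ r, (∏ s, θ (e s * (x r / x s) * q ^ k r)) * θ (g * x r / (∏ i, e i) * q ^ k r) *
      ∏ s ∈ univ.erase r, (θ (g * q ^ (∑ i, k i) * (x s * q ^ k s)) /
        θ (x r * q ^ k r / (x s * q ^ k s))) =
    θ ((∏ i, e i) * q ^ (∑ i, k i)) * ∏ i, θ (g * x i / e i * q ^ (∑ i, k i)) := by
  have key := hθ.partial_fraction univ (fun i => x i * q ^ k i)
    (fun i => mul_ne_zero (hx i) (pow_ne_zero _ hq)) (fun i _ j _ => h i j)
    (fun i => e i * q ^ k i) (fun i => mul_ne_zero (he i) (pow_ne_zero _ hq))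
    (g * q ^ (∑ i, k i)) (mul_ne_zero hg (pow_ne_zero _ hq))
  have hE : ∏ i, e i ≠ 0 := prod_ne_zero_iff.2 fun i _ => he i
  simp only [prod_mul_distrib, prod_pow_eq_pow_sum] at key
  refine Eq.trans ?_ (key.trans ?_)
  · refine sum_congr rfl fun r _ => ?_
    congr 2
    · refine prod_congr rfl fun s _ => ?_
      congr 1
      have := hx s
      field_simp
    · congr 1
      field_simp
  · congr 1
    refine prod_congr rfl fun i _ => ?_
    congr 1
    have := he i
    field_simp

/-- Sums over pairs of a tuple of degree `K + 1` and an index correspond to sums over pairs of a tuple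
of degree `K` and an index, except for the pairs whose coordinate is zero. -/
theorem sum_piAntidiag_succ {ι : Type*} [Fintype ι] [DecidableEq ι] (K : ℕ)
    (F : (ι → ℕ) → ι → ℂ) (h : ∀ k r, k r = 0 → F k r = 0) :
    ∑ k ∈ piAntidiag univ (K + 1), ∑ r, F k r =
      ∑ k ∈ piAntidiag univ K, ∑ r, F (k + Pi.single r 1) r := by
  rw [sum_comm, sum_comm (s := piAntidiag univ K)]
  refine sum_congr rfl fun r _ => (sum_of_injOn (fun k => k + Pi.single r 1) ?_ ?_ ?_ ?_).symm
  · exact fun k _ l _ hkl => add_right_cancel hkl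
  · intro k hk
    simp only [mem_coe, mem_piAntidiag, mem_univ, implies_true, and_true] at hk ⊢
    simp [sum_add_distrib, hk]
  · intro k hk hk'
    refine h k r (by_contra fun h0 => hk' ⟨k - Pi.single r 1, ?_, ?_⟩)
    · have hle : k - Pi.single r 1 + Pi.single r 1 = k := by
        funext i
        by_cases hi : i = r
        · subst hi; simp; omega
        · simp [Pi.single_eq_of_ne hi]
      have hs := congrArg (fun f : ι → ℕ => ∑ i, f i) hle
      simp only [Pi.add_apply, sum_add_distrib] at hs
      simp only [mem_piAntidiag, mem_univ, implies_true, and_true] at hk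
      rw [hk] at hs
      simp only [mem_coe, mem_piAntidiag, mem_univ, implies_true, and_true]
      simp at hs ⊢
      exact hs
    · funext i
      by_cases hi : i = r
      · subst hi; simp; omega
      · simp [Pi.single_eq_of_ne hi]
  · intros; rfl

/-- The type `A` summation: the sum of all terms of total degree `K` factors. Both the factor that
leads from degree `K` to degree `K + 1` on the right and the weights by which a term of degree
`K + 1` is redistributed over its predecessors come from the partial fraction expansion. -/
theorem sum_kernelTerm (hθ : IsTheta θ) {n N : ℕ} {q : ℂ} (hq : q ≠ 0) {x e : Fin n → ℂ}
    {g : ℂ} (hg : g ≠ 0) (hx : ∀ i, x i ≠ 0) (he : ∀ i, e i ≠ 0)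
    (h : ∀ i j, i ≠ j → ∀ k ≤ N, ∀ l ≤ N, θ (x i * q ^ k / (x j * q ^ l)) ≠ 0)
    (hqN : sf θ q q N ≠ 0) (hgN : ∀ r, sf θ q (g * x r) N ≠ 0) {K : ℕ} (hK : K ≤ N) :
    (∑ k ∈ piAntidiag univ K, kernelTerm θ q x e g k) * (sf θ q q K * ∏ r, sf θ q (g * x r) K) =
      q ^ K * sf θ q (∏ i, e i) K * ∏ r, sf θ q (g * x r / e r) K := by
  induction K with
  | zero =>
    have : ∏ r : Fin n, ∏ s ∈ Ioi r, θ (x r / x s) ≠ 0 :=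
      prod_ne_zero_iff.2 fun r _ => prod_ne_zero_iff.2 fun s hs => by
        simpa using h r s (mem_Ioi.1 hs).ne 0 (by omega) 0 (by omega)
    simp [kernelTerm, sf_zero, div_self this]
  | succ K ih =>
    have ih := ih (by omega)
    have hle : ∀ k ∈ piAntidiag (univ : Finset (Fin n)) K, ∀ i, k i ≤ K := fun k hk i => by
      rw [mem_piAntidiag] at hk
      rw [← hk.1]
      exact single_le_sum (fun _ _ => Nat.zero_le _) (mem_univ i)
    have hle' : ∀ k ∈ piAntidiag (univ : Finset (Fin n)) (K + 1), ∀ i, k i ≤ K + 1 := fun k hk i => by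
      rw [mem_piAntidiag] at hk
      rw [← hk.1]
      exact single_le_sum (fun _ _ => Nat.zero_le _) (mem_univ i)
    -- the weights by which a term of degree `K + 1` is distributed over its predecessors: this is the
    -- partial fraction expansion with all `e i = 1`
    let T2 : (Fin n → ℕ) → Fin n → ℂ := fun k r =>
      (∏ s, θ (1 * (x r / x s) * q ^ k r)) * θ (g / q * x r / (∏ _i : Fin n, 1) * q ^ k r) *
      ∏ s ∈ univ.erase r, (θ (g / q * q ^ (K + 1) * (x s * q ^ k s)) /
        θ (x r * q ^ k r / (x s * q ^ k s)))
    -- the expansion of the factor that leads from degree `K` to degree `K + 1`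
    let T1 : (Fin n → ℕ) → Fin n → ℂ := fun k r =>
      (∏ s, θ (e s * (x r / x s) * q ^ k r)) * θ (g * x r / (∏ i, e i) * q ^ k r) *
      ∏ s ∈ univ.erase r, (θ (g * q ^ K * (x s * q ^ k s)) /
        θ (x r * q ^ k r / (x s * q ^ k s)))
    have k2 : ∀ k ∈ piAntidiag (univ : Finset (Fin n)) (K + 1), ∑ r, T2 k r =
        θ (q * q ^ K) * ∏ r, θ (g * x r * q ^ K) := fun k hk => by
      have := hθ.partial_fraction_shift hq (x := x) (e := fun _ => 1) (div_ne_zero hg hq) hx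
        (fun _ => one_ne_zero) k (fun i j hij => h i j hij _ ((hle' k hk i).trans hK) _
          ((hle' k hk j).trans hK))
      rw [(mem_piAntidiag.1 hk).1] at this
      rw [this]
      simp only [prod_const_one, one_mul, pow_succ', div_one]
      congr 1
      refine prod_congr rfl fun i _ => ?_
      congr 1
      field_simp
    have k1 : ∀ k ∈ piAntidiag (univ : Finset (Fin n)) K, ∑ r, T1 k r =
        θ ((∏ i, e i) * q ^ K) * ∏ i, θ (g * x i / e i * q ^ K) := fun k hk => by
      have := hθ.partial_fraction_shift hq hg hx he k (fun i j hij => h i j hij _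
        ((hle k hk i).trans (by omega)) _ ((hle k hk j).trans (by omega)))
      rw [(mem_piAntidiag.1 hk).1] at this
      exact this
    have step : (∑ k ∈ piAntidiag univ (K + 1), kernelTerm θ q x e g k) *
        (θ (q * q ^ K) * ∏ r, θ (g * x r * q ^ K)) =
        (∑ k ∈ piAntidiag univ K, kernelTerm θ q x e g k) *
        (q * (θ ((∏ i, e i) * q ^ K) * ∏ i, θ (g * x i / e i * q ^ K))) := by
      calc _ = ∑ k ∈ piAntidiag univ (K + 1), ∑ r, kernelTerm θ q x e g k * T2 k r := by
            rw [sum_mul]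
            refine sum_congr rfl fun k hk => ?_
            rw [← k2 k hk, mul_sum]
        _ = ∑ k ∈ piAntidiag univ K, ∑ r, kernelTerm θ q x e g (k + Pi.single r 1) *
              T2 (k + Pi.single r 1) r := by
            refine sum_piAntidiag_succ K (fun k r => kernelTerm θ q x e g k * T2 k r) ?_
            intro k r hk
            have : ∏ s, θ (1 * (x r / x s) * q ^ k r) = 0 :=
              prod_eq_zero (mem_univ r) (by rw [hk, div_self (hx r)]; simp [hθ.one])
            simp only [T2]
            rw [this]
            ring
        _ = ∑ k ∈ piAntidiag univ K, ∑ r, q * kernelTerm θ q x e g k * T1 k r := by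
            refine sum_congr rfl fun k hk => sum_congr rfl fun r _ => ?_
            have hkr := hle k hk r
            have hn1 : ∀ s, θ (q * (x r / x s) * q ^ k r) ≠ 0 := fun s => by
              by_cases hs : r = s
              · subst hs
                rw [div_self (hx r), mul_one]
                exact sf_ne_zero.1 hqN _ (by omega)
              · have := h r s hs (k r + 1) (by omega) 0 (by omega)
                convert this using 2
                rw [pow_succ]; ring
            have hr := hθ.kernelTerm_succ hq (e := e) hx k r hn1
              (sf_ne_zero.1 (hgN r) _ (by omega))
            have hn2 : ∏ s ∈ univ.erase r, θ (x r * q ^ k r / (x s * q ^ k s)) ≠ 0 :=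
              prod_ne_zero_iff.2 fun s hs => h r s (ne_of_mem_erase hs).symm _ (by omega) _
                ((hle k hk s).trans (by omega))
            have hn3 : ∏ s ∈ univ.erase r, θ (q * (x r * q ^ k r) / (x s * q ^ k s)) ≠ 0 :=
              prod_ne_zero_iff.2 fun s hs => by
                have := h r s (ne_of_mem_erase hs).symm (k r + 1) (by omega) _
                  ((hle k hk s).trans (show K ≤ N by omega))
                convert this using 2
                rw [pow_succ]; ring
            have e1 : T2 (k + Pi.single r 1) r = (∏ s, θ (q * (x r / x s) * q ^ k r)) *
                θ (g * x r * q ^ k r) * ((∏ s ∈ univ.erase r, θ (g * q ^ K * (x s * q ^ k s))) /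
                ∏ s ∈ univ.erase r, θ (q * (x r * q ^ k r) / (x s * q ^ k s))) := by
              simp only [T2, prod_div_distrib]
              congr 2
              · refine prod_congr rfl fun s _ => ?_
                congr 1
                simp [pow_succ]; ring
              · congr 1
                simp [pow_succ]
                field_simp
              · refine prod_congr rfl fun s hs => ?_
                congr 1
                simp only [Pi.add_apply, Pi.single_eq_of_ne (ne_of_mem_erase hs), pow_succ, add_zero]
                field_simp
              · refine prod_congr rfl fun s hs => ?_
                congr 1
                simp [Pi.single_eq_of_ne (ne_of_mem_erase hs), pow_succ]
                ring
            have e2 : T1 k r = (∏ s, θ (e s * (x r / x s) * q ^ k r)) *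
                θ (g * x r / (∏ i, e i) * q ^ k r) *
                ((∏ s ∈ univ.erase r, θ (g * q ^ K * (x s * q ^ k s))) /
                ∏ s ∈ univ.erase r, θ (x r * q ^ k r / (x s * q ^ k s))) := by
              simp only [T1, prod_div_distrib]
            rw [e1, e2, ← mul_div_assoc, ← mul_div_assoc, ← mul_div_assoc, ← mul_div_assoc,
              div_eq_div_iff hn3 hn2]
            linear_combination (∏ s ∈ univ.erase r, θ (g * q ^ K * (x s * q ^ k s))) * hr
        _ = _ := by
            rw [sum_mul]
            refine sum_congr rfl fun k hk => ?_
            rw [← mul_sum, k1 k hk]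
            ring
    simp only [sf_succ, prod_mul_distrib]
    rw [pow_succ]
    linear_combination (sf θ q q K * ∏ r, sf θ q (g * x r) K) * step +
      q * (θ ((∏ i, e i) * q ^ K) * ∏ i, θ (g * x i / e i * q ^ K)) * ih

end IsTheta

/-! ### The Frenkel–Turaev summation -/

theorem sf_add (θ : ℂ → ℂ) (q a : ℂ) (k l : ℕ) :
    sf θ q a (k + l) = sf θ q a k * sf θ q (a * q ^ k) l := by
  simp only [sf, prod_range_add, pow_add, mul_assoc]

theorem sf_succ' (θ : ℂ → ℂ) (q a : ℂ) (k : ℕ) :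
    sf θ q a (k + 1) = θ a * sf θ q (a * q) k := by
  rw [add_comm, sf_add, pow_one]
  simp [sf]

/-- The factor, independent of the base point, that appears when a theta shifted factorial of length
`K` is read backwards in its last `k` factors. -/
noncomputable def revFactor (q : ℂ) (K k : ℕ) : ℂ := ∏ i ∈ range k, -(q ^ (K - 1 - i))

theorem revFactor_ne_zero {q : ℂ} (hq : q ≠ 0) (K k : ℕ) : revFactor q K k ≠ 0 :=
  prod_ne_zero_iff.2 fun _ _ => neg_ne_zero.2 (pow_ne_zero _ hq)

/-- Rewrites the sum over pairs with given total as a sum over the first entry. -/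
theorem sum_piAntidiag_two (K : ℕ) (F : (Fin 2 → ℕ) → ℂ) :
    ∑ k ∈ piAntidiag univ K, F k = ∑ k ∈ range (K + 1), F ![k, K - k] := by
  refine sum_nbij' (fun k => k 0) (fun k => ![k, K - k]) ?_ ?_ ?_ ?_ ?_
  · intro k hk
    simp only [mem_piAntidiag, Fin.sum_univ_two] at hk
    simp only [mem_range]
    omega
  · intro k hk
    simp only [mem_range] at hk
    simp only [mem_piAntidiag, Fin.sum_univ_two, mem_univ, implies_true, and_true,
      Matrix.cons_val_zero, Matrix.cons_val_one]
    omega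
  · intro k hk
    simp only [mem_piAntidiag, Fin.sum_univ_two] at hk
    funext i
    fin_cases i
    · rfl
    · simp; omega
  · intro k _
    rfl
  · intro k hk
    simp only [mem_piAntidiag, Fin.sum_univ_two] at hk
    congr 1
    funext i
    fin_cases i
    · rfl
    · simp; omega

namespace IsTheta

variable {θ : ℂ → ℂ}

/-- Reads the last `k` of `K` theta functions backwards, by the inversion formula. -/
theorem sf_reverse (hθ : IsTheta θ) {q u : ℂ} (hq : q ≠ 0) (hu : u ≠ 0) {K k : ℕ} (hk : k ≤ K) :
    sf θ q u (K - k) * sf θ q (q / (q ^ K * u)) k * u ^ k * revFactor q K k = sf θ q u K := by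
  induction k with
  | zero => simp [sf_zero, revFactor]
  | succ k ih =>
    rw [← ih (by omega), show K - k = K - (k + 1) + 1 by omega, sf_succ, sf_succ, pow_succ,
      revFactor, prod_range_succ, ← revFactor]
    have h1 : u * q ^ (K - (k + 1)) ≠ 0 := mul_ne_zero hu (pow_ne_zero _ hq)
    have h2 : q / (q ^ K * u) * q ^ k = (u * q ^ (K - (k + 1)))⁻¹ := by
      have : q ^ K = q ^ (K - (k + 1)) * q ^ k * q := by
        rw [← pow_add, ← pow_succ]; congr 1; omega
      rw [this]
      field_simp
    rw [h2, hθ.inv _ h1, show K - 1 - k = K - (k + 1) by omega]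
    field_simp

theorem sf_reverse_ne_zero (hθ : IsTheta θ) {q u : ℂ} (hq : q ≠ 0) (hu : u ≠ 0) {K k : ℕ}
    (h : sf θ q u K ≠ 0) (hk : k ≤ K) : sf θ q (q / (q ^ K * u)) k ≠ 0 := by
  intro h0
  rw [← hθ.sf_reverse hq hu hk, h0] at h
  simp at h

/-- In two variables the terms of fixed degree are the terms of a very well-poised series in one
variable, up to a constant factor. -/
theorem kernelTerm_two (hθ : IsTheta θ) {q : ℂ} (hq : q ≠ 0) {a b c d e : ℂ}
    (ha : a ≠ 0) (hb : b ≠ 0) (hc : c ≠ 0) (hd : d ≠ 0) {K k : ℕ} (hk : k ≤ K)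
    (hbal : a ^ 2 * q ^ (K + 1) = b * c * d * e) (hq' : sf θ q q K ≠ 0)
    (ha' : sf θ q (q / (a * q ^ K)) K ≠ 0)
    (hb' : sf θ q (a * q / b) K ≠ 0) (hc' : sf θ q (a * q / c) K ≠ 0)
    (hd' : sf θ q (a * q / d) K ≠ 0)
    (hg : sf θ q (b * c * d / (a * q ^ K) ^ 2) K ≠ 0) :
    kernelTerm θ q ![a * q ^ K, 1] ![b, c / (a * q ^ K)] (b * c * d / (a * q ^ K) ^ 2) ![k, K - k] =
      sf θ q (b / (a * q ^ K)) K * sf θ q (c / (a * q ^ K)) K * sf θ q (d / (a * q ^ K)) K /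
        (θ (a * q ^ K) * sf θ q (q / (a * q ^ K)) K * sf θ q q K *
          sf θ q (b * c * d / (a * q ^ K) ^ 2) K) * q ^ (2 * K) *
      (θ (a * q ^ (2 * k)) * (sf θ q a k * sf θ q b k * sf θ q c k * sf θ q d k * sf θ q e k *
        sf θ q (q ^ K)⁻¹ k) / (sf θ q q k * sf θ q (a * q / b) k * sf θ q (a * q / c) k *
        sf θ q (a * q / d) k * sf θ q (a * q / e) k * sf θ q (a * q ^ (K + 1)) k) * q ^ k) := by
  have hK : q ^ K ≠ 0 := pow_ne_zero _ hq
  have he : e ≠ 0 := by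
    rintro rfl
    rw [mul_zero] at hbal
    exact mul_ne_zero (pow_ne_zero _ ha) (pow_ne_zero _ hq) hbal
  have hx0 : a * q ^ K ≠ 0 := mul_ne_zero ha hK
  -- reading the factorials of length `K - k` backwards
  have rv : ∀ u v : ℂ, u ≠ 0 → q / (q ^ K * u) = v →
      sf θ q u (K - k) * sf θ q v k * u ^ k * revFactor q K k = sf θ q u K := by
    rintro u _ hu rfl
    exact hθ.sf_reverse hq hu hk
  have rb := rv (b / (a * q ^ K)) (a * q / b) (div_ne_zero hb hx0) (by field_simp)
  have rc := rv (c / (a * q ^ K)) (a * q / c) (div_ne_zero hc hx0) (by field_simp)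
  have rd := rv (d / (a * q ^ K)) (a * q / d) (div_ne_zero hd hx0) (by field_simp)
  have ra := rv (q / (a * q ^ K)) a (div_ne_zero hq hx0) (by field_simp)
  have rq := rv q (q ^ K)⁻¹ hq (by field_simp)
  have hg0 : b * c * d / (a * q ^ K) ^ 2 ≠ 0 := by positivity
  have rg := rv (b * c * d / (a * q ^ K) ^ 2) e hg0 (by
    have : e = a ^ 2 * q ^ (K + 1) / (b * c * d) := by
      rw [hbal]; field_simp
    rw [this]
    field_simp
    ring)
  have i0 : Ioi (0 : Fin 2) = {1} := rfl
  have i1 : Ioi (1 : Fin 2) = ∅ := rfl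
  have e1 : q ^ ((k : ℤ) - ((K - k : ℕ) : ℤ)) * (a * q ^ K) = a * q ^ (2 * k) := by
    rw [Nat.cast_sub hk, show (k : ℤ) - ((K : ℤ) - k) = ((2 * k : ℕ) : ℤ) - (K : ℕ) by
      push_cast; ring, zpow_sub₀ hq, zpow_natCast, zpow_natCast]
    field_simp
  have e3 : b * c * d / (a * q ^ K) ^ 2 * (a * q ^ K) = a * q / e := by
    have : e = a ^ 2 * q ^ (K + 1) / (b * c * d) := by
      rw [hbal]; field_simp
    rw [this]
    field_simp
    ring
  have e2 : a * q / e / (b * (c / (a * q ^ K))) = d := by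
    rw [← e3]; field_simp
  have e4 : b * c * d / (a * q ^ K) ^ 2 / (b * (c / (a * q ^ K))) = d / (a * q ^ K) := by
    field_simp
  have e5 : q * (a * q ^ K) = a * q ^ (K + 1) := by ring
  have e8 : c / (a * q ^ K) * (a * q ^ K) = c := div_mul_cancel₀ _ hx0
  have e6 : q ^ (1 * k + 2 * (K - k)) * (q ^ 2) ^ k = q ^ (2 * K) * q ^ k := by
    rw [← pow_mul, ← pow_add, ← pow_add]; congr 1; omega
  have e7 : (b / (a * q ^ K)) ^ k * (c / (a * q ^ K)) ^ k * (d / (a * q ^ K)) ^ k * (q ^ 2) ^ k =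
      (q / (a * q ^ K)) ^ k * q ^ k * (b * c * d / (a * q ^ K) ^ 2) ^ k := by
    rw [← mul_pow, ← mul_pow, ← mul_pow, ← mul_pow, ← mul_pow]
    congr 1
    field_simp
  have ek : (q / (a * q ^ K)) ^ k * q ^ k * (b * c * d / (a * q ^ K) ^ 2) ^ k /
      ((b / (a * q ^ K)) ^ k * (c / (a * q ^ K)) ^ k * (d / (a * q ^ K)) ^ k) = (q ^ 2) ^ k :=
    (div_eq_iff (by positivity)).2 (by rw [← e7]; ring)
  have er : sf θ q (b / (a * q ^ K)) (K - k) * sf θ q (c / (a * q ^ K)) (K - k) *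
      sf θ q (d / (a * q ^ K)) (K - k) / (sf θ q (q / (a * q ^ K)) (K - k) * sf θ q q (K - k) *
        sf θ q (b * c * d / (a * q ^ K) ^ 2) (K - k)) =
      sf θ q (b / (a * q ^ K)) K * sf θ q (c / (a * q ^ K)) K * sf θ q (d / (a * q ^ K)) K /
        (sf θ q (q / (a * q ^ K)) K * sf θ q q K * sf θ q (b * c * d / (a * q ^ K) ^ 2) K) *
      (sf θ q a k * sf θ q (q ^ K)⁻¹ k * sf θ q e k /
        (sf θ q (a * q / b) k * sf θ q (a * q / c) k * sf θ q (a * q / d) k)) * (q ^ 2) ^ k := by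
    rw [← ek]
    have nb := sf_ne_zero_of_le hb' hk
    have nc := sf_ne_zero_of_le hc' hk
    have nd := sf_ne_zero_of_le hd' hk
    have nw := revFactor_ne_zero hq K k
    have ub : (b / (a * q ^ K)) ^ k ≠ 0 := pow_ne_zero _ (div_ne_zero hb hx0)
    have uc : (c / (a * q ^ K)) ^ k ≠ 0 := pow_ne_zero _ (div_ne_zero hc hx0)
    have ud : (d / (a * q ^ K)) ^ k ≠ 0 := pow_ne_zero _ (div_ne_zero hd hx0)
    rw [← ra] at ha'
    rw [← rq] at hq'
    rw [← rg] at hg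
    rw [← ra, ← rq, ← rg, ← rb, ← rc, ← rd]
    simp only [mul_ne_zero_iff] at ha' hq' hg
    obtain ⟨⟨⟨ha1, ha2⟩, ha3⟩, -⟩ := ha'
    obtain ⟨⟨⟨hq1, hq2⟩, hq3⟩, -⟩ := hq'
    obtain ⟨⟨⟨hg1, hg2⟩, hg3⟩, -⟩ := hg
    generalize (b / (a * q ^ K)) ^ k = ub at *
    generalize (c / (a * q ^ K)) ^ k = uc at *
    generalize (d / (a * q ^ K)) ^ k = ud at *
    generalize (q / (a * q ^ K)) ^ k = ua at *
    generalize (b * c * d / (a * q ^ K) ^ 2) ^ k = ug at *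
    generalize q ^ k = uq at *
    generalize sf θ q (b / (a * q ^ K)) (K - k) = s1 at *
    generalize sf θ q (c / (a * q ^ K)) (K - k) = s2 at *
    generalize sf θ q (d / (a * q ^ K)) (K - k) = s3 at *
    generalize sf θ q (q / (a * q ^ K)) (K - k) = s4 at *
    generalize sf θ q (b * c * d / (a * q ^ K) ^ 2) (K - k) = s5 at *
    generalize sf θ q q (K - k) = s6 at *
    generalize sf θ q (a * q / b) k = t1 at *
    generalize sf θ q (a * q / c) k = t2 at *
    generalize sf θ q (a * q / d) k = t3 at *
    generalize sf θ q a k = t4 at *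
    generalize sf θ q e k = t5 at *
    generalize sf θ q (q ^ K)⁻¹ k = t6 at *
    generalize revFactor q K k = w at *
    clear * - nb nc nd nw ub uc ud ha1 ha2 ha3 hq1 hq2 hq3 hg1 hg2 hg3
    field_simp
  simp only [kernelTerm, Fin.prod_univ_two, Fin.sum_univ_two, i0, i1, prod_singleton, prod_empty,
    Matrix.cons_val_zero, Matrix.cons_val_one, div_self hx0, div_one, mul_one, e1, e2, e3, e4, e5, e8,
    mul_one_div, Fin.val_zero, Fin.val_one, zero_add, one_add_one_eq_two]
  calc _ = θ (a * q ^ (2 * k)) / θ (a * q ^ K) * (sf θ q b k / sf θ q q k) *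
        (sf θ q c k / sf θ q (a * q ^ (K + 1)) k) * (sf θ q d k / sf θ q (a * q / e) k) *
        (sf θ q (b / (a * q ^ K)) (K - k) * sf θ q (c / (a * q ^ K)) (K - k) *
        sf θ q (d / (a * q ^ K)) (K - k) / (sf θ q (q / (a * q ^ K)) (K - k) * sf θ q q (K - k) *
        sf θ q (b * c * d / (a * q ^ K) ^ 2) (K - k))) * q ^ (1 * k + 2 * (K - k)) := by ring
    _ = θ (a * q ^ (2 * k)) / θ (a * q ^ K) * (sf θ q b k / sf θ q q k) *
        (sf θ q c k / sf θ q (a * q ^ (K + 1)) k) * (sf θ q d k / sf θ q (a * q / e) k) *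
        (sf θ q (b / (a * q ^ K)) K * sf θ q (c / (a * q ^ K)) K * sf θ q (d / (a * q ^ K)) K /
        (sf θ q (q / (a * q ^ K)) K * sf θ q q K * sf θ q (b * c * d / (a * q ^ K) ^ 2) K) *
      (sf θ q a k * sf θ q (q ^ K)⁻¹ k * sf θ q e k /
        (sf θ q (a * q / b) k * sf θ q (a * q / c) k * sf θ q (a * q / d) k))) *
        (q ^ (1 * k + 2 * (K - k)) * (q ^ 2) ^ k) := by rw [er]; ring
    _ = _ := by rw [e6]; ring

/-- The Frenkel–Turaev summation, obtained from the type `A` summation in two variables. -/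
theorem frenkel_turaev (hθ : IsTheta θ) {q : ℂ} (hq : q ≠ 0) {a b c d e : ℂ}
    (ha : a ≠ 0) (hb : b ≠ 0) (hc : c ≠ 0) (hd : d ≠ 0) {K : ℕ}
    (hbal : a ^ 2 * q ^ (K + 1) = b * c * d * e) (hq' : sf θ q q K ≠ 0)
    (ha' : ∀ l ≤ 2 * K, θ (a * q ^ l) ≠ 0)
    (hb' : sf θ q (a * q / b) K ≠ 0) (hc' : sf θ q (a * q / c) K ≠ 0)
    (hd' : sf θ q (a * q / d) K ≠ 0) (he' : sf θ q (a * q / e) K ≠ 0) (he : sf θ q e K ≠ 0) :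
    ∑ k ∈ range (K + 1),
      (θ (a * q ^ (2 * k)) * (sf θ q a k * sf θ q b k * sf θ q c k * sf θ q d k * sf θ q e k *
        sf θ q (q ^ K)⁻¹ k) / (sf θ q q k * sf θ q (a * q / b) k * sf θ q (a * q / c) k *
        sf θ q (a * q / d) k * sf θ q (a * q / e) k * sf θ q (a * q ^ (K + 1)) k) * q ^ k) =
    θ a * (sf θ q (a * q) K * sf θ q (a * q / (b * c)) K * sf θ q (a * q / (b * d)) K *
        sf θ q (a * q / (c * d)) K) / (sf θ q (a * q / b) K * sf θ q (a * q / c) K *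
        sf θ q (a * q / d) K * sf θ q (a * q / (b * c * d)) K) := by
  have hK : q ^ K ≠ 0 := pow_ne_zero _ hq
  have he0 : e ≠ 0 := by
    rintro rfl
    rw [mul_zero] at hbal
    exact mul_ne_zero (pow_ne_zero _ ha) (pow_ne_zero _ hq) hbal
  have hx0 : a * q ^ K ≠ 0 := mul_ne_zero ha hK
  have hg0 : b * c * d / (a * q ^ K) ^ 2 ≠ 0 := by positivity
  have hee : e = a ^ 2 * q ^ (K + 1) / (b * c * d) := by rw [hbal]; field_simp
  -- reading a full factorial backwards
  have rv : ∀ u v : ℂ, u ≠ 0 → q / (q ^ K * u) = v →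
      sf θ q u K = sf θ q v K * u ^ K * revFactor q K K := by
    rintro u _ hu rfl
    simpa [sf_zero] using (hθ.sf_reverse hq hu (le_refl K)).symm
  have nz : ∀ u v : ℂ, u ≠ 0 → q / (q ^ K * u) = v → sf θ q u K ≠ 0 → sf θ q v K ≠ 0 := by
    rintro u _ hu rfl h
    exact hθ.sf_reverse_ne_zero hq hu h le_rfl
  have hg : sf θ q (b * c * d / (a * q ^ K) ^ 2) K ≠ 0 := nz e _ he0 (by
    rw [hee]; field_simp; ring) he
  have hgx : b * c * d / (a * q ^ K) ^ 2 * (a * q ^ K) = a * q / e := by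
    rw [hee]; field_simp; ring
  have haa : sf θ q a K ≠ 0 := sf_ne_zero.2 fun j hj => ha' j (by omega)
  have hqa : sf θ q (q / (a * q ^ K)) K ≠ 0 := nz a _ ha (by field_simp) haa
  have h01 : ∀ k ≤ K, ∀ l ≤ K, θ (a * q ^ K * q ^ k / (1 * q ^ l)) ≠ 0 := fun k hk l hl => by
    have := ha' (K + k - l) (by omega)
    rw [pow_sub₀ _ hq (by omega), pow_add] at this
    convert this using 2
    field_simp
  have key := hθ.sum_kernelTerm (N := K) hq (x := ![a * q ^ K, 1]) (e := ![b, c / (a * q ^ K)])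
    (g := b * c * d / (a * q ^ K) ^ 2) hg0
    (by intro i; fin_cases i <;> simp [ha, hq])
    (by intro i; fin_cases i <;> simp [ha, hb, hc, hq])
    (by
      intro i j hij k hk l hl
      fin_cases i <;> fin_cases j <;> simp only [Fin.zero_eta, Fin.mk_one, ne_eq,
        not_true_eq_false, Matrix.cons_val_zero, Matrix.cons_val_one] at hij ⊢
      · exact h01 k hk l hl
      · intro h
        refine h01 l hl k hk ?_
        rw [hθ.div_comm (mul_ne_zero hx0 (pow_ne_zero _ hq))
          (mul_ne_zero one_ne_zero (pow_ne_zero _ hq)), h, mul_zero])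
    hq'
    (by
      intro r
      fin_cases r
      · simpa only [Fin.zero_eta, Matrix.cons_val_zero, hgx] using he'
      · simpa using hg)
    (le_refl K)
  rw [sum_piAntidiag_two, sum_congr rfl fun k hk => hθ.kernelTerm_two hq ha hb hc hd
    (Nat.lt_succ_iff.1 (mem_range.1 hk)) hbal hq' hqa hb' hc' hd' hg, ← mul_sum] at key
  generalize ∑ k ∈ range (K + 1), (_ : ℂ) = S at key ⊢
  have f1 : a * q / e / b = c * d / (a * q ^ K) := by rw [hee]; field_simp; ring
  have f2 : b * c * d / (a * q ^ K) ^ 2 / (c / (a * q ^ K)) = b * d / (a * q ^ K) := by field_simp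
  have f3 : b * (c / (a * q ^ K)) = b * c / (a * q ^ K) := by field_simp
  simp only [Fin.prod_univ_two, Matrix.cons_val_zero, Matrix.cons_val_one, mul_one, hgx, f1, f2,
    f3] at key
  have rb := rv (b / (a * q ^ K)) (a * q / b) (div_ne_zero hb hx0) (by field_simp)
  have rc := rv (c / (a * q ^ K)) (a * q / c) (div_ne_zero hc hx0) (by field_simp)
  have rd := rv (d / (a * q ^ K)) (a * q / d) (div_ne_zero hd hx0) (by field_simp)
  have ra := rv (q / (a * q ^ K)) a (div_ne_zero hq hx0) (by field_simp)
  have rbc := rv (b * c / (a * q ^ K)) (a * q / (b * c)) (by positivity) (by field_simp)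
  have rbd := rv (b * d / (a * q ^ K)) (a * q / (b * d)) (by positivity) (by field_simp)
  have rcd := rv (c * d / (a * q ^ K)) (a * q / (c * d)) (by positivity) (by field_simp)
  have re := rv (a * q / e) (a * q / (b * c * d)) (by positivity) (by
    rw [hee]; field_simp; ring)
  have nbcd : sf θ q (a * q / (b * c * d)) K ≠ 0 :=
    nz (a * q / e) _ (by positivity) (by rw [hee]; field_simp; ring) he'
  have hθx : θ (a * q ^ K) ≠ 0 := ha' K (by omega)
  have hshift : sf θ q a K * θ (a * q ^ K) = θ a * sf θ q (a * q) K := by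
    rw [← sf_succ, sf_succ']
  have e7 : (q / (a * q ^ K)) ^ K * (b * c / (a * q ^ K)) ^ K * (b * d / (a * q ^ K)) ^ K *
      (c * d / (a * q ^ K)) ^ K = q ^ K * ((b / (a * q ^ K)) ^ K * (c / (a * q ^ K)) ^ K *
      (d / (a * q ^ K)) ^ K * (a * q / e) ^ K) := by
    simp only [← mul_pow]
    congr 1
    rw [hee]
    field_simp
    ring
  have key2 : sf θ q (b / (a * q ^ K)) K * sf θ q (c / (a * q ^ K)) K *
      sf θ q (d / (a * q ^ K)) K * (q ^ K * q ^ K) * S * sf θ q (a * q / e) K =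
      q ^ K * sf θ q (b * c / (a * q ^ K)) K * (sf θ q (c * d / (a * q ^ K)) K *
        sf θ q (b * d / (a * q ^ K)) K) * (θ (a * q ^ K) * sf θ q (q / (a * q ^ K)) K) := by
    have aux : ∀ A t p Q S s E g : ℂ, t ≠ 0 → p ≠ 0 → s ≠ 0 → g ≠ 0 →
        A * Q * S * E = A / (t * p * s * g) * Q * S * (s * (E * g)) * (t * p) := by
      intro A t p Q S s E g _ _ _ _
      field_simp
    rw [← key, two_mul, pow_add]
    exact aux _ _ _ _ _ _ _ _ hθx hqa hq' hg
  rw [rb, rc, rd, ra, rbc, rbd, rcd, re] at key2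
  have nw := revFactor_ne_zero hq K K
  have ue : (a * q / e) ^ K ≠ 0 := pow_ne_zero _ (by positivity)
  have ub : (b / (a * q ^ K)) ^ K ≠ 0 := pow_ne_zero _ (div_ne_zero hb hx0)
  have uc : (c / (a * q ^ K)) ^ K ≠ 0 := pow_ne_zero _ (div_ne_zero hc hx0)
  have ud : (d / (a * q ^ K)) ^ K ≠ 0 := pow_ne_zero _ (div_ne_zero hd hx0)
  have nM : (b / (a * q ^ K)) ^ K * (c / (a * q ^ K)) ^ K * (d / (a * q ^ K)) ^ K *
      (a * q / e) ^ K * revFactor q K K ^ 4 * (q ^ K * q ^ K) ≠ 0 := by positivity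
  rw [eq_div_iff (by positivity)]
  apply mul_left_cancel₀ nM
  linear_combination key2 + sf θ q (a * q / (b * c)) K * sf θ q (a * q / (b * d)) K *
    sf θ q (a * q / (c * d)) K * revFactor q K K ^ 4 * q ^ K * (sf θ q a K * θ (a * q ^ K) * e7 +
    q ^ K * ((b / (a * q ^ K)) ^ K * (c / (a * q ^ K)) ^ K *
      (d / (a * q ^ K)) ^ K * (a * q / e) ^ K) * hshift)

end IsTheta

/-! ### The elliptic Bailey transformation -/

theorem sum_range_range_swap (N : ℕ) (f : ℕ → ℕ → ℂ) :
    ∑ k ∈ range (N + 1), ∑ j ∈ range (k + 1), f k j =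
      ∑ j ∈ range (N + 1), ∑ i ∈ range (N - j + 1), f (j + i) j := by
  rw [sum_comm' (t' := range (N + 1)) (s' := fun j => Ico j (N + 1))]
  · refine sum_congr rfl fun j hj => ?_
    rw [sum_Ico_eq_sum_range, Nat.sub_add_comm (Nat.lt_succ_iff.1 (mem_range.1 hj))]
  · intro k j
    simp only [mem_range, mem_Ico]
    omega

namespace IsTheta

variable {θ : ℂ → ℂ}

/-- The coefficients of a very well-poised series, expanded by the Frenkel–Turaev summation: this
is the first of the two summations in Bailey's argument. -/
theorem wellPoised_expansion (hθ : IsTheta θ) {q a b c d lam : ℂ} (hq : q ≠ 0) (ha : a ≠ 0)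
    (hb : b ≠ 0) (hc : c ≠ 0) (hd : d ≠ 0) (hl : lam ≠ 0) (hlam : lam * (b * c * d) = q * a ^ 2)
    {k : ℕ} (hqk : sf θ q q k ≠ 0) (hlk : ∀ l ≤ 2 * k, θ (lam * q ^ l) ≠ 0)
    (hbk : sf θ q (a * q / b) k ≠ 0) (hck : sf θ q (a * q / c) k ≠ 0)
    (hdk : sf θ q (a * q / d) k ≠ 0) (hal : sf θ q (a / lam) k ≠ 0)
    (hak : sf θ q (a * q ^ k) k ≠ 0) :
    sf θ q a k * sf θ q b k * sf θ q c k * sf θ q d k /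
      (sf θ q q k * sf θ q (a * q / b) k * sf θ q (a * q / c) k * sf θ q (a * q / d) k) =
    ∑ j ∈ range (k + 1), θ (lam * q ^ (2 * j)) / θ lam *
      (sf θ q lam j * sf θ q (lam * b / a) j * sf θ q (lam * c / a) j * sf θ q (lam * d / a) j /
        (sf θ q q j * sf θ q (a * q / b) j * sf θ q (a * q / c) j * sf θ q (a * q / d) j)) *
      (a / lam) ^ j *
      (sf θ q a (k + j) * sf θ q (a / lam) (k - j) / (sf θ q (lam * q) (k + j) * sf θ q q (k - j))) := by
  have hk : q ^ k ≠ 0 := pow_ne_zero _ hq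
  have hll : lam = q * a ^ 2 / (b * c * d) := by rw [← hlam]; field_simp
  have hA : a / lam ≠ 0 := div_ne_zero ha hl
  have g1 : ∀ u : ℂ, u ≠ 0 → lam * q / (lam * u / a) = a * q / u := fun u hu => by field_simp
  have g2 : lam * q / (lam * b / a * (lam * c / a)) = d := by rw [hll]; field_simp
  have g3 : lam * q / (lam * b / a * (lam * d / a)) = c := by rw [hll]; field_simp
  have g4 : lam * q / (lam * c / a * (lam * d / a)) = b := by rw [hll]; field_simp
  have g5 : lam * q / (lam * b / a * (lam * c / a) * (lam * d / a)) = a / lam := by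
    rw [hll]; field_simp
  have g6 : q / (q ^ k * (a / lam)) = lam * q / (a * q ^ k) := by field_simp
  have g7 : q / (q ^ k * q) = (q ^ k)⁻¹ := by field_simp
  have hlq : sf θ q (lam * q) k ≠ 0 := sf_ne_zero.2 fun j hj => by
    rw [mul_assoc, ← pow_succ']; exact hlk _ (by omega)
  have hl0 : θ lam ≠ 0 := by simpa using hlk 0 (by omega)
  have hrev := hθ.sf_reverse_ne_zero hq hA hal le_rfl
  rw [g6] at hrev
  have ft := hθ.frenkel_turaev hq (a := lam) (b := lam * b / a) (c := lam * c / a)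
    (d := lam * d / a) (e := a * q ^ k) hl (by positivity) (by positivity) (by positivity)
    (K := k) (by rw [hll]; field_simp; ring) hqk hlk (by rwa [g1 b hb]) (by rwa [g1 c hc])
    (by rwa [g1 d hd]) hrev hak
  rw [g1 b hb, g1 c hc, g1 d hd, g2, g3, g4, g5] at ft
  have hterm : ∀ j ∈ range (k + 1), θ (lam * q ^ (2 * j)) / θ lam *
      (sf θ q lam j * sf θ q (lam * b / a) j * sf θ q (lam * c / a) j * sf θ q (lam * d / a) j /
        (sf θ q q j * sf θ q (a * q / b) j * sf θ q (a * q / c) j * sf θ q (a * q / d) j)) *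
      (a / lam) ^ j *
      (sf θ q a (k + j) * sf θ q (a / lam) (k - j) / (sf θ q (lam * q) (k + j) * sf θ q q (k - j)))
      = (θ (lam * q ^ (2 * j)) * (sf θ q lam j * sf θ q (lam * b / a) j * sf θ q (lam * c / a) j *
        sf θ q (lam * d / a) j * sf θ q (a * q ^ k) j * sf θ q (q ^ k)⁻¹ j) /
        (sf θ q q j * sf θ q (a * q / b) j * sf θ q (a * q / c) j * sf θ q (a * q / d) j *
        sf θ q (lam * q / (a * q ^ k)) j * sf θ q (lam * q ^ (k + 1)) j) * q ^ j) *
        (sf θ q a k * sf θ q (a / lam) k / (θ lam * sf θ q q k * sf θ q (lam * q) k)) := by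
    intro j hj
    have hjk := Nat.lt_succ_iff.1 (mem_range.1 hj)
    have r1 := hθ.sf_reverse hq hA hjk
    have r2 := hθ.sf_reverse hq hq hjk
    rw [g6] at r1
    rw [g7] at r2
    have nr := sf_ne_zero_of_le hrev hjk
    have nw := revFactor_ne_zero hq k j
    rw [← r2] at hqk
    simp only [mul_ne_zero_iff] at hqk
    obtain ⟨⟨⟨n1, n2⟩, n3⟩, -⟩ := hqk
    have e1 : (a / lam) ^ j * (sf θ q (a / lam) (k - j) / sf θ q q (k - j)) =
        sf θ q (q ^ k)⁻¹ j / sf θ q (lam * q / (a * q ^ k)) j * q ^ j *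
          (sf θ q (a / lam) k / sf θ q q k) := by
      have aux : ∀ A S n p s Q w : ℂ, n ≠ 0 → p ≠ 0 → s ≠ 0 → Q ≠ 0 → w ≠ 0 →
          A * (S / n) = p / s * Q * ((S * s * A * w) / (n * p * Q * w)) := by
        intro A S n p s Q w _ _ _ _ _
        field_simp
      rw [← r1, ← r2]
      exact aux _ _ _ _ _ _ _ n1 n2 nr n3 nw
    rw [sf_add, sf_add, show lam * q * q ^ k = lam * q ^ (k + 1) by ring]
    calc _ = θ (lam * q ^ (2 * j)) / θ lam *
      (sf θ q lam j * sf θ q (lam * b / a) j * sf θ q (lam * c / a) j * sf θ q (lam * d / a) j /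
        (sf θ q q j * sf θ q (a * q / b) j * sf θ q (a * q / c) j * sf θ q (a * q / d) j)) *
      ((a / lam) ^ j * (sf θ q (a / lam) (k - j) / sf θ q q (k - j))) *
      (sf θ q a k * sf θ q (a * q ^ k) j) /
      (sf θ q (lam * q) k * sf θ q (lam * q ^ (k + 1)) j) := by ring
      _ = _ := by rw [e1]; ring
  rw [sum_congr rfl hterm, ← sum_mul, ft]
  have aux : ∀ t L A B C D s X Y Z Q : ℂ, t ≠ 0 → L ≠ 0 → s ≠ 0 →
      A * B * C * D / (Q * X * Y * Z) =
      t * (L * D * C * B) / (X * Y * Z * s) * (A * s / (t * Q * L)) := by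
    intro t L A B C D s X Y Z Q _ _ _
    field_simp
  exact aux _ _ _ _ _ _ _ _ _ _ _ hl0 hlq hal

/-- The second of the two summations in Bailey's argument: the tail of a very well-poised series,
again by the Frenkel–Turaev summation. -/
theorem wellPoised_tail_sum (hθ : IsTheta θ) {q a lam E F mu : ℂ} (hq : q ≠ 0) (ha : a ≠ 0)
    (hl : lam ≠ 0) (hE : E ≠ 0) (hF : F ≠ 0) (hmu : mu ≠ 0) {N : ℕ}
    (hbal : mu * (E * F) = lam * a * q ^ (N + 1)) (hqN : sf θ q q N ≠ 0)
    (haN : ∀ l ≤ 2 * N, θ (a * q ^ l) ≠ 0) (hlN : ∀ l ≤ 2 * N, θ (lam * q ^ l) ≠ 0)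
    (hEN : sf θ q (a * q / E) N ≠ 0) (hFN : sf θ q (a * q / F) N ≠ 0)
    (hmN : sf θ q (a * q / mu) N ≠ 0) (hmuN : sf θ q mu N ≠ 0)
    (hlE : sf θ q (lam * q / E) N ≠ 0) (hlF : sf θ q (lam * q / F) N ≠ 0)
    (hlm : sf θ q (lam * q / mu) N ≠ 0) (hlEF : sf θ q (lam * q / (E * F)) N ≠ 0)
    {j : ℕ} (hj : j ≤ N) :
    ∑ i ∈ range (N - j + 1), θ (a * q ^ (2 * (j + i))) *
      (sf θ q a (j + i + j) * sf θ q (a / lam) (j + i - j) /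
        (sf θ q (lam * q) (j + i + j) * sf θ q q (j + i - j))) *
      (sf θ q E (j + i) * sf θ q F (j + i) * sf θ q mu (j + i) * sf θ q (q ^ N)⁻¹ (j + i) /
        (sf θ q (a * q / E) (j + i) * sf θ q (a * q / F) (j + i) * sf θ q (a * q / mu) (j + i) *
          sf θ q (a * q ^ (N + 1)) (j + i))) * q ^ (j + i) =
    θ a * (sf θ q (a * q) N * sf θ q (a * q / (E * F)) N * sf θ q (lam * q / E) N *
      sf θ q (lam * q / F) N / (sf θ q (a * q / E) N * sf θ q (a * q / F) N * sf θ q (lam * q) N *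
      sf θ q (lam * q / (E * F)) N)) *
      (sf θ q E j * sf θ q F j * sf θ q mu j * sf θ q (q ^ N)⁻¹ j /
        (sf θ q (lam * q / E) j * sf θ q (lam * q / F) j * sf θ q (lam * q / mu) j *
          sf θ q (lam * q ^ (N + 1)) j)) * (lam / a) ^ j * q ^ j := by
  obtain ⟨M, rfl⟩ := Nat.exists_eq_add_of_le hj
  have hjM : j + M - j = M := by omega
  rw [hjM]
  have hqj : q ^ j ≠ 0 := pow_ne_zero _ hq
  have hqM : q ^ M ≠ 0 := pow_ne_zero _ hq
  have hmm : mu = lam * a * q ^ (j + M + 1) / (E * F) := by rw [← hbal]; field_simp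
  have split : ∀ u : ℂ, sf θ q u (j + M) ≠ 0 → sf θ q (u * q ^ j) M ≠ 0 := fun u hu => by
    rw [sf_add] at hu; exact right_ne_zero_of_mul hu
  have low : ∀ u : ℂ, sf θ q u (j + M) ≠ 0 → sf θ q u j ≠ 0 := fun u hu =>
    sf_ne_zero_of_le hu hj
  have g1 : a * q ^ (2 * j) * q / (a / lam) = lam * q * q ^ (2 * j) := by field_simp
  have g2 : ∀ u : ℂ, u ≠ 0 → a * q ^ (2 * j) * q / (u * q ^ j) = a * q / u * q ^ j := fun u hu => by
    field_simp
    ring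
  have g3 : ∀ u : ℂ, u ≠ 0 → a * q ^ (2 * j) * q / (a / lam * (u * q ^ j)) = lam * q / u * q ^ j :=
    fun u hu => by
      field_simp
      ring
  have g4 : a * q ^ (2 * j) * q / (E * q ^ j * (F * q ^ j)) = a * q / (E * F) := by
    field_simp
    ring
  have g5 : a * q ^ (2 * j) * q / (a / lam * (E * q ^ j) * (F * q ^ j)) = lam * q / (E * F) := by
    field_simp
    ring
  have hlq : ∀ l ≤ 2 * (j + M), sf θ q (lam * q) l ≠ 0 := fun l hl' => sf_ne_zero.2 fun i hi => by
    rw [mul_assoc, ← pow_succ']; exact hlN _ (by omega)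
  have ft := hθ.frenkel_turaev hq (a := a * q ^ (2 * j)) (b := a / lam) (c := E * q ^ j)
    (d := F * q ^ j) (e := mu * q ^ j) (mul_ne_zero ha (pow_ne_zero _ hq)) (div_ne_zero ha hl)
    (mul_ne_zero hE hqj) (mul_ne_zero hF hqj) (K := M) (by rw [hmm]; field_simp; ring)
    (sf_ne_zero_of_le hqN (by omega))
    (fun l hl' => by rw [mul_assoc, ← pow_add]; exact haN _ (by omega))
    (by
      rw [g1]
      have := hlq (2 * j + M) (by omega)
      rw [sf_add] at this
      exact right_ne_zero_of_mul this)
    (by rw [g2 E hE]; exact split _ hEN) (by rw [g2 F hF]; exact split _ hFN)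
    (by rw [g2 mu hmu]; exact split _ hmN) (split _ hmuN)
  rw [g1, g2 E hE, g2 F hF, g2 mu hmu, g3 E hE, g3 F hF, g4, g5] at ft
  have hterm : ∀ i ∈ range (M + 1), θ (a * q ^ (2 * (j + i))) *
      (sf θ q a (j + i + j) * sf θ q (a / lam) (j + i - j) /
        (sf θ q (lam * q) (j + i + j) * sf θ q q (j + i - j))) *
      (sf θ q E (j + i) * sf θ q F (j + i) * sf θ q mu (j + i) *
        sf θ q (q ^ (j + M))⁻¹ (j + i) /
        (sf θ q (a * q / E) (j + i) * sf θ q (a * q / F) (j + i) * sf θ q (a * q / mu) (j + i) *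
          sf θ q (a * q ^ (j + M + 1)) (j + i))) * q ^ (j + i) =
      (sf θ q a (2 * j) / sf θ q (lam * q) (2 * j) *
        (sf θ q E j * sf θ q F j * sf θ q mu j * sf θ q (q ^ (j + M))⁻¹ j /
        (sf θ q (a * q / E) j * sf θ q (a * q / F) j * sf θ q (a * q / mu) j *
          sf θ q (a * q ^ (j + M + 1)) j)) * q ^ j) *
      (θ (a * q ^ (2 * j) * q ^ (2 * i)) * (sf θ q (a * q ^ (2 * j)) i * sf θ q (a / lam) i *
        sf θ q (E * q ^ j) i * sf θ q (F * q ^ j) i * sf θ q (mu * q ^ j) i * sf θ q (q ^ M)⁻¹ i) /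
        (sf θ q q i * sf θ q (lam * q * q ^ (2 * j)) i * sf θ q (a * q / E * q ^ j) i *
        sf θ q (a * q / F * q ^ j) i * sf θ q (a * q / mu * q ^ j) i *
        sf θ q (a * q ^ (2 * j) * q ^ (M + 1)) i) * q ^ i) := by
    intro i _
    have t1 : (q ^ (j + M))⁻¹ * q ^ j = (q ^ M)⁻¹ := by rw [pow_add]; field_simp
    have t2 : a * q ^ (j + M + 1) * q ^ j = a * q ^ (2 * j) * q ^ (M + 1) := by ring
    have t3 : a * q ^ (2 * (j + i)) = a * q ^ (2 * j) * q ^ (2 * i) := by ring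
    rw [Nat.add_sub_cancel_left, show j + i + j = 2 * j + i by ring, t3, sf_add θ q a (2 * j),
      sf_add θ q (lam * q) (2 * j), sf_add θ q E, sf_add θ q F, sf_add θ q mu, sf_add θ q _⁻¹,
      sf_add θ q (a * q / E), sf_add θ q (a * q / F), sf_add θ q (a * q / mu),
      sf_add θ q (a * q ^ (j + M + 1)), t1, t2, pow_add q j i]
    ring
  rw [sum_congr rfl hterm, ← mul_sum, ft]
  have hEF : E * F ≠ 0 := mul_ne_zero hE hF
  have v1 : q / (q ^ (j + M) * (a * q / (E * F))) = lam * q / mu := by rw [hmm]; field_simp; ring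
  have v2 : q / (q ^ (j + M) * (lam * q / (E * F))) = a * q / mu := by rw [hmm]; field_simp; ring
  have r1 := hθ.sf_reverse hq (u := a * q / (E * F)) (by positivity) hj
  have r2 := hθ.sf_reverse hq (u := lam * q / (E * F)) (by positivity) hj
  rw [v1, hjM] at r1
  rw [v2, hjM] at r2
  have s1 : sf θ q a (2 * j) * (θ (a * q ^ (2 * j)) * sf θ q (a * q ^ (2 * j) * q) M) =
      θ a * (sf θ q (a * q) (j + M) * sf θ q (a * q ^ (j + M + 1)) j) := by
    rw [← sf_succ', ← sf_add, show a * q ^ (j + M + 1) = a * q * q ^ (j + M) by ring, ← sf_add,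
      ← sf_succ']
    congr 1
    omega
  have s2 : sf θ q (lam * q) (2 * j) * sf θ q (lam * q * q ^ (2 * j)) M =
      sf θ q (lam * q) (j + M) * sf θ q (lam * q ^ (j + M + 1)) j := by
    rw [← sf_add, show lam * q ^ (j + M + 1) = lam * q * q ^ (j + M) by ring, ← sf_add]
    congr 1
    omega
  have s3 := sf_add θ q (lam * q / E) j M
  have s4 := sf_add θ q (lam * q / F) j M
  have s5 := sf_add θ q (a * q / E) j M
  have s6 := sf_add θ q (a * q / F) j M
  have naN : sf θ q (a * q ^ (j + M + 1)) j ≠ 0 := sf_ne_zero.2 fun i hi => by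
    rw [mul_assoc, ← pow_add]; exact haN _ (by omega)
  have nw := revFactor_ne_zero hq (j + M) j
  have nla : (lam / a) ^ j * (a * q / (E * F)) ^ j = (lam * q / (E * F)) ^ j := by
    rw [← mul_pow]; congr 1; field_simp
  have nEFj : (lam * q / (E * F)) ^ j ≠ 0 := pow_ne_zero _ (by positivity)
  have naEFj : (a * q / (E * F)) ^ j ≠ 0 := pow_ne_zero _ (by positivity)
  have n1 := low _ hlE
  have n2 := low _ hlF
  have n3 := low _ hlm
  have n4 := low _ hmN
  have hr : sf θ q (a * q / (E * F)) M / sf θ q (lam * q / (E * F)) M =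
      sf θ q (a * q / (E * F)) (j + M) / sf θ q (lam * q / (E * F)) (j + M) *
      (sf θ q (a * q / mu) j / sf θ q (lam * q / mu) j) * (lam / a) ^ j := by
    rw [← r1]
    rw [← r2] at hlEF ⊢
    rw [← nla]
    have nM := left_ne_zero_of_mul (left_ne_zero_of_mul (left_ne_zero_of_mul hlEF))
    have nl : (lam / a) ^ j ≠ 0 := pow_ne_zero _ (div_ne_zero hl ha)
    have aux : ∀ S T x y z s w : ℂ, T ≠ 0 → x ≠ 0 → y ≠ 0 → z ≠ 0 → s ≠ 0 → w ≠ 0 →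
        S / T = (S * x * y * w) / (T * s * (z * y) * w) * (s / x) * z := by
      intro S T x y z s w _ _ _ _ _ _
      field_simp
    exact aux _ _ _ _ _ _ _ nM n3 naEFj nl n4 nw
  have aux : ∀ t saq aN lq lN P aE aF am x y xj yj R L Lm z Q : ℂ, aN ≠ 0 → am ≠ 0 → xj ≠ 0 →
      yj ≠ 0 → t * (saq * aN) / (lq * lN) * (P / (aE * aF * am * aN)) * (x * y) *
        (R / L * (am / Lm) * z) * Q =
      t * (saq * R * (xj * x) * (yj * y) / (aE * aF * lq * L)) * (P / (xj * yj * Lm * lN)) * z * Q := by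
    intro t saq aN lq lN P aE aF am x y xj yj R L Lm z Q h1 h2 h3 h4
    calc _ = t * saq * P * x * y * R * z * Q / (lq * lN * aE * aF * L * Lm) * (aN / aN) *
          (am / am) := by ring
      _ = t * saq * P * x * y * R * z * Q / (lq * lN * aE * aF * L * Lm) * (xj / xj) *
          (yj / yj) := by rw [div_self h1, div_self h2, div_self h3, div_self h4]
      _ = _ := by ring
  rw [s3, s4, ← aux _ _ _ _ _ _ _ _ _ _ _ _ _ _ _ _ _ _ naN n4 n1 n2, ← hr, ← s1, ← s2, s5, s6]
  ring

end IsTheta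

/-- The very well-poised elliptic series `₁₂V₁₁`, terminated by the parameter `q ^ (-N)`. The base
points `B`, `C`, `D`, which stand for `aq/b`, `aq/c`, `aq/d`, are kept as separate arguments, because
the transformation leaves them unchanged. -/
noncomputable def wpSeries (θ : ℂ → ℂ) (q : ℂ) (N : ℕ) (a b c d B C D E F mu : ℂ) : ℂ :=
  ∑ k ∈ range (N + 1), θ (a * q ^ (2 * k)) / θ a *
    (sf θ q a k * sf θ q b k * sf θ q c k * sf θ q d k /
      (sf θ q q k * sf θ q B k * sf θ q C k * sf θ q D k)) *
    (sf θ q E k * sf θ q F k * sf θ q mu k * sf θ q (q ^ N)⁻¹ k /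
      (sf θ q (a * q / E) k * sf θ q (a * q / F) k * sf θ q (a * q / mu) k *
        sf θ q (a * q ^ (N + 1)) k)) * q ^ k

/-- The factor in front of the transformed series in the elliptic Bailey transformation. -/
noncomputable def wpFactor (θ : ℂ → ℂ) (q : ℂ) (N : ℕ) (a lam E F : ℂ) : ℂ :=
  sf θ q (a * q) N * sf θ q (a * q / (E * F)) N * sf θ q (lam * q / E) N *
    sf θ q (lam * q / F) N / (sf θ q (a * q / E) N * sf θ q (a * q / F) N * sf θ q (lam * q) N *
    sf θ q (lam * q / (E * F)) N)

namespace IsTheta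

variable {θ : ℂ → ℂ}

/-- The elliptic Bailey transformation for parameters in general position. -/
theorem wpSeries_transformation_of_generic (hθ : IsTheta θ) {q a b c d B C D b' c' d' lam E F mu : ℂ}
    (hq : q ≠ 0) (ha : a ≠ 0) (hb : b ≠ 0) (hc : c ≠ 0) (hd : d ≠ 0) (hl : lam ≠ 0) (hE : E ≠ 0)
    (hF : F ≠ 0) (hmu : mu ≠ 0) (hlam : lam * (b * c * d) = q * a ^ 2)
    (hB : B * b = a * q) (hC : C * c = a * q) (hD : D * d = a * q)
    (hb' : b' * a = lam * b) (hc' : c' * a = lam * c) (hd' : d' * a = lam * d) {N : ℕ}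
    (hbal : mu * (E * F) = lam * a * q ^ (N + 1)) (hqN : sf θ q q N ≠ 0)
    (haN : ∀ l ≤ 2 * N, θ (a * q ^ l) ≠ 0) (hlN : ∀ l ≤ 2 * N, θ (lam * q ^ l) ≠ 0)
    (halN : sf θ q (a / lam) N ≠ 0)
    (hBN : sf θ q B N ≠ 0) (hCN : sf θ q C N ≠ 0) (hDN : sf θ q D N ≠ 0)
    (hEN : sf θ q (a * q / E) N ≠ 0) (hFN : sf θ q (a * q / F) N ≠ 0)
    (hmN : sf θ q (a * q / mu) N ≠ 0) (hmuN : sf θ q mu N ≠ 0)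
    (hlE : sf θ q (lam * q / E) N ≠ 0) (hlF : sf θ q (lam * q / F) N ≠ 0)
    (hlm : sf θ q (lam * q / mu) N ≠ 0) (hlEF : sf θ q (lam * q / (E * F)) N ≠ 0) :
    wpSeries θ q N a b c d B C D E F mu =
      wpFactor θ q N a lam E F * wpSeries θ q N lam b' c' d' B C D E F mu := by
  obtain rfl : B = a * q / b := eq_div_of_mul_eq hb hB
  obtain rfl : C = a * q / c := eq_div_of_mul_eq hc hC
  obtain rfl : D = a * q / d := eq_div_of_mul_eq hd hD
  obtain rfl : b' = lam * b / a := eq_div_of_mul_eq ha hb'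
  obtain rfl : c' = lam * c / a := eq_div_of_mul_eq ha hc'
  obtain rfl : d' = lam * d / a := eq_div_of_mul_eq ha hd'
  have ha0 : θ a ≠ 0 := by simpa using haN 0 (by omega)
  let α : ℕ → ℂ := fun j => θ (lam * q ^ (2 * j)) / θ lam *
      (sf θ q lam j * sf θ q (lam * b / a) j * sf θ q (lam * c / a) j * sf θ q (lam * d / a) j /
        (sf θ q q j * sf θ q (a * q / b) j * sf θ q (a * q / c) j * sf θ q (a * q / d) j)) *
      (a / lam) ^ j
  let T : ℕ → ℕ → ℂ := fun k j => θ (a * q ^ (2 * k)) *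
      (sf θ q a (k + j) * sf θ q (a / lam) (k - j) / (sf θ q (lam * q) (k + j) * sf θ q q (k - j))) *
      (sf θ q E k * sf θ q F k * sf θ q mu k * sf θ q (q ^ N)⁻¹ k /
        (sf θ q (a * q / E) k * sf θ q (a * q / F) k * sf θ q (a * q / mu) k *
          sf θ q (a * q ^ (N + 1)) k)) * q ^ k
  have h1 : wpSeries θ q N a b c d (a * q / b) (a * q / c) (a * q / d) E F mu =
      (θ a)⁻¹ * ∑ k ∈ range (N + 1), ∑ j ∈ range (k + 1), α j * T k j := by
    rw [wpSeries, mul_sum]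
    refine sum_congr rfl fun k hk => ?_
    have hkN := Nat.lt_succ_iff.1 (mem_range.1 hk)
    rw [hθ.wellPoised_expansion hq ha hb hc hd hl hlam (sf_ne_zero_of_le hqN hkN)
      (fun l hl' => hlN l (by omega)) (sf_ne_zero_of_le hBN hkN) (sf_ne_zero_of_le hCN hkN)
      (sf_ne_zero_of_le hDN hkN) (sf_ne_zero_of_le halN hkN)
      (sf_ne_zero.2 fun i hi => by rw [mul_assoc, ← pow_add]; exact haN _ (by omega))]
    rw [mul_sum, sum_mul, sum_mul, mul_sum]
    refine sum_congr rfl fun j _ => ?_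
    simp only [α, T]
    ring
  rw [h1, sum_range_range_swap, wpSeries, mul_sum, mul_sum]
  refine sum_congr rfl fun j hj => ?_
  rw [← mul_sum, hθ.wellPoised_tail_sum hq ha hl hE hF hmu hbal hqN haN hlN hEN hFN hmN hmuN hlE hlF
    hlm hlEF (Nat.lt_succ_iff.1 (mem_range.1 hj))]
  have e1 : (a / lam) ^ j * (lam / a) ^ j = 1 := by
    rw [← mul_pow, div_mul_div_cancel₀ hl, div_self ha, one_pow]
  simp only [α, wpFactor]
  generalize (a / lam) ^ j = u at *
  generalize (lam / a) ^ j = v at *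
  generalize θ a = t at *
  rw [← mul_one (_ / _ * (_ / _) * (_ / _) * q ^ j), ← e1, ← mul_one (u * v), ← div_self ha0]
  ring

theorem continuousAt_sf (hθ : IsTheta θ) {q : ℂ} (hq : q ≠ 0) {f : ℂ → ℂ} {t : ℂ}
    (hf : ContinuousAt f t) (h0 : f t ≠ 0) (k : ℕ) : ContinuousAt (fun s => sf θ q (f s) k) t :=
  tendsto_finsetProd _ fun _ _ => hθ.continuousAt_comp (hf.mul_const _)
    (mul_ne_zero h0 (pow_ne_zero _ hq))

theorem continuousAt_wpSeries (hθ : IsTheta θ) {q : ℂ} (hq : q ≠ 0) {N : ℕ} {E F t : ℂ}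
    {a b c d B C D mu : ℂ → ℂ} (ha : ContinuousAt a t) (hb : ContinuousAt b t)
    (hc : ContinuousAt c t) (hd : ContinuousAt d t) (hB : ContinuousAt B t) (hC : ContinuousAt C t)
    (hD : ContinuousAt D t) (hmu : ContinuousAt mu t) (ha0 : a t ≠ 0) (hb0 : b t ≠ 0)
    (hc0 : c t ≠ 0) (hd0 : d t ≠ 0) (hB0 : B t ≠ 0) (hC0 : C t ≠ 0) (hD0 : D t ≠ 0)
    (hmu0 : mu t ≠ 0) (hE0 : E ≠ 0) (hF0 : F ≠ 0) (h1 : θ (a t) ≠ 0) (hqN : sf θ q q N ≠ 0)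
    (hBN : sf θ q (B t) N ≠ 0) (hCN : sf θ q (C t) N ≠ 0) (hDN : sf θ q (D t) N ≠ 0)
    (hEN : sf θ q (a t * q / E) N ≠ 0) (hFN : sf θ q (a t * q / F) N ≠ 0)
    (hmN : sf θ q (a t * q / mu t) N ≠ 0) (haN : sf θ q (a t * q ^ (N + 1)) N ≠ 0) :
    ContinuousAt (fun s => wpSeries θ q N (a s) (b s) (c s) (d s) (B s) (C s) (D s) E F (mu s)) t := by
  refine tendsto_finsetSum _ fun k hk => ?_
  have hkN := Nat.lt_succ_iff.1 (mem_range.1 hk)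
  have le : ∀ {u : ℂ}, sf θ q u N ≠ 0 → sf θ q u k ≠ 0 := fun h => sf_ne_zero_of_le h hkN
  have cs := fun {f : ℂ → ℂ} (hf : ContinuousAt f t) (h0 : f t ≠ 0) =>
    hθ.continuousAt_sf hq hf h0 k
  have cc : ∀ u : ℂ, ContinuousAt (fun _ : ℂ => u) t := fun u => continuousAt_const
  refine ContinuousAt.mul (ContinuousAt.mul (ContinuousAt.mul ?_ ?_) ?_) (cc _)
  · exact (hθ.continuousAt_comp (ha.mul_const _) (mul_ne_zero ha0 (pow_ne_zero _ hq))).div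
      (hθ.continuousAt_comp ha ha0) h1
  · refine ContinuousAt.div (((((cs ha ha0).mul (cs hb hb0)).mul (cs hc hc0)).mul (cs hd hd0)))
      (((((cc _).mul (cs hB hB0)).mul (cs hC hC0)).mul (cs hD hD0))) ?_
    exact mul_ne_zero (mul_ne_zero (mul_ne_zero (le hqN) (le hBN)) (le hCN)) (le hDN)
  · refine ContinuousAt.div (((((cc _).mul (cc _)).mul (cs hmu hmu0)).mul (cc _)))
      ((((cs ((ha.mul_const _).div_const _) (div_ne_zero (mul_ne_zero ha0 hq) hE0)).mul
        (cs ((ha.mul_const _).div_const _) (div_ne_zero (mul_ne_zero ha0 hq) hF0))).mul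
        (cs ((ha.mul_const _).div hmu hmu0) (div_ne_zero (mul_ne_zero ha0 hq) hmu0))).mul
        (cs (ha.mul_const _) (mul_ne_zero ha0 (pow_ne_zero _ hq)))) ?_
    exact mul_ne_zero (mul_ne_zero (mul_ne_zero (le hEN) (le hFN)) (le hmN)) (le haN)

theorem countable_setOf_exists_mul (hθ : IsTheta θ) {q c : ℂ} (hq : q ≠ 0) (hc : c ≠ 0) :
    {t | ∃ l : ℕ, θ (t * c * q ^ l) = 0}.Countable := by
  have : {t | ∃ l : ℕ, θ (t * c * q ^ l) = 0} = ⋃ l : ℕ, {t | θ (t * (c * q ^ l)) = 0} := by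
    ext t; simp [mul_assoc]
  rw [this]
  exact Set.countable_iUnion fun l => hθ.countable_setOf_mul (mul_ne_zero hc (pow_ne_zero _ hq))

theorem countable_setOf_exists_div (hθ : IsTheta θ) {q c : ℂ} (hq : q ≠ 0) (hc : c ≠ 0) :
    {t | ∃ l : ℕ, θ (c / t * q ^ l) = 0}.Countable := by
  have : {t | ∃ l : ℕ, θ (c / t * q ^ l) = 0} = ⋃ l : ℕ, (fun t => c / t * q ^ l) ⁻¹' {u | θ u = 0} := by
    ext t; simp
  rw [this]
  refine Set.countable_iUnion fun l => hθ.countable_zeros.preimage fun s t hst => ?_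
  have h := mul_right_cancel₀ (pow_ne_zero l hq) hst
  simp only [div_eq_mul_inv] at h
  exact inv_injective (mul_left_cancel₀ hc h)

/-- The elliptic Bailey transformation of Frenkel and Turaev. The general case follows from the
generic one by moving `a`, `b`, `c` to `ta`, `tb`, `tc`, which fixes `lam`, and letting `t` tend
to `1`. -/
theorem wpSeries_transformation (hθ : IsTheta θ) {q a b c d B C D b' c' d' lam E F mu : ℂ}
    (hq : q ≠ 0) (ha : a ≠ 0) (hb : b ≠ 0) (hc : c ≠ 0) (hd : d ≠ 0) (hl : lam ≠ 0) (hE : E ≠ 0)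
    (hF : F ≠ 0) (hmu : mu ≠ 0) (hlam : lam * (b * c * d) = q * a ^ 2)
    (hB : B * b = a * q) (hC : C * c = a * q) (hD : D * d = a * q)
    (hb' : b' * a = lam * b) (hc' : c' * a = lam * c) (hd' : d' * a = lam * d) {N : ℕ}
    (hbal : mu * (E * F) = lam * a * q ^ (N + 1)) (hqN : sf θ q q N ≠ 0)
    (ha0 : θ a ≠ 0) (haN : sf θ q (a * q ^ (N + 1)) N ≠ 0)
    (hlN : ∀ l ≤ 2 * N, θ (lam * q ^ l) ≠ 0)
    (hBN : sf θ q B N ≠ 0) (hCN : sf θ q C N ≠ 0) (hDN : sf θ q D N ≠ 0)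
    (hEN : sf θ q (a * q / E) N ≠ 0) (hFN : sf θ q (a * q / F) N ≠ 0)
    (hmN : sf θ q (a * q / mu) N ≠ 0)
    (hlE : sf θ q (lam * q / E) N ≠ 0) (hlF : sf θ q (lam * q / F) N ≠ 0)
    (hlm : sf θ q (lam * q / mu) N ≠ 0) (hlEF : sf θ q (lam * q / (E * F)) N ≠ 0) :
    wpSeries θ q N a b c d B C D E F mu =
      wpFactor θ q N a lam E F * wpSeries θ q N lam b' c' d' B C D E F mu := by
  have nz : ∀ {x y : ℂ}, x * y ≠ 0 → x ≠ 0 := fun h => left_ne_zero_of_mul h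
  have haq : a * q ≠ 0 := mul_ne_zero ha hq
  have hB0 : B ≠ 0 := nz (hB ▸ haq)
  have hC0 : C ≠ 0 := nz (hC ▸ haq)
  have hD0 : D ≠ 0 := nz (hD ▸ haq)
  have hb0 : b' ≠ 0 := nz (hb' ▸ mul_ne_zero hl hb)
  have hc0 : c' ≠ 0 := nz (hc' ▸ mul_ne_zero hl hc)
  have hd0 : d' ≠ 0 := nz (hd' ▸ mul_ne_zero hl hd)
  have hlq : sf θ q (lam * q) N ≠ 0 := sf_ne_zero.2 fun i hi => by
    rw [mul_assoc, ← pow_succ']; exact hlN _ (by omega)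
  have hl0 : θ lam ≠ 0 := by simpa using hlN 0 (by omega)
  have hlN' : sf θ q (lam * q ^ (N + 1)) N ≠ 0 := sf_ne_zero.2 fun i hi => by
    rw [mul_assoc, ← pow_add]; exact hlN _ (by omega)
  have c1 : ∀ u : ℂ, ContinuousAt (fun t : ℂ => t * u) 1 := fun u => by fun_prop
  have cc : ∀ u : ℂ, ContinuousAt (fun _ : ℂ => u) 1 := fun u => continuousAt_const
  have key := eq_at_one_of_eq_off_countable
    (f := fun t => wpSeries θ q N (t * a) (t * b) (t * c) d B C (t * D) E F (t * mu))
    (g := fun t => wpFactor θ q N (t * a) lam E F *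
      wpSeries θ q N lam b' c' (d' / t) B C (t * D) E F (t * mu))
    -- the values of `t` for which the generic transformation is not available
    (S := {0} ∪ {t | ∃ l : ℕ, θ (t * a * q ^ l) = 0} ∪ {t | ∃ l : ℕ, θ (t * (a / lam) * q ^ l) = 0} ∪
      {t | ∃ l : ℕ, θ (t * D * q ^ l) = 0} ∪ {t | ∃ l : ℕ, θ (t * (a * q / E) * q ^ l) = 0} ∪
      {t | ∃ l : ℕ, θ (t * (a * q / F) * q ^ l) = 0} ∪ {t | ∃ l : ℕ, θ (t * mu * q ^ l) = 0} ∪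
      {t | ∃ l : ℕ, θ (lam * q / mu / t * q ^ l) = 0}) ?_ ?_ ?_ ?_
  · simpa only [one_mul, div_one] using key
  · exact ((((((((Set.countable_singleton _).union (hθ.countable_setOf_exists_mul hq ha)).union
      (hθ.countable_setOf_exists_mul hq (div_ne_zero ha hl))).union
      (hθ.countable_setOf_exists_mul hq hD0)).union
      (hθ.countable_setOf_exists_mul hq (div_ne_zero haq hE))).union
      (hθ.countable_setOf_exists_mul hq (div_ne_zero haq hF))).union
      (hθ.countable_setOf_exists_mul hq hmu)).union
      (hθ.countable_setOf_exists_div hq (div_ne_zero (mul_ne_zero hl hq) hmu)))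
  · apply hθ.continuousAt_wpSeries hq (c1 a) (c1 b) (c1 c) (cc d) (cc B) (cc C) (c1 D) (c1 mu) <;>
      first | assumption | (simp only [one_mul]; assumption)
  · refine ContinuousAt.mul ?_ ?_
    · have cs := fun {f : ℂ → ℂ} (hf : ContinuousAt f 1) (h0 : f 1 ≠ 0) =>
        hθ.continuousAt_sf hq hf h0 N
      unfold wpFactor
      refine ContinuousAt.div
        ((((cs ((c1 a).mul_const q) ?_).mul (cs (((c1 a).mul_const q).div_const _) ?_)).mul
          (cc _)).mul (cc _)) ((((cs (((c1 a).mul_const q).div_const _) ?_).mul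
          (cs (((c1 a).mul_const q).div_const _) ?_)).mul (cc _)).mul (cc _)) ?_
      · simpa using ⟨ha, hq⟩
      · simp [ha, hq, hE, hF]
      · simp [ha, hq, hE]
      · simp [ha, hq, hF]
      · simp only [one_mul]
        exact mul_ne_zero (mul_ne_zero (mul_ne_zero hEN hFN) hlq) hlEF
    · apply hθ.continuousAt_wpSeries hq (cc lam) (cc b') (cc c')
        (continuousAt_const.div continuousAt_id one_ne_zero) (cc B) (cc C) (c1 D) (c1 mu) <;>
      first | assumption | (simp only [one_mul]; assumption) | simpa using hd0
  · intro t ht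
    simp only [Set.mem_union, Set.mem_singleton_iff, Set.mem_ofPred_eq, not_or, not_exists] at ht
    obtain ⟨⟨⟨⟨⟨⟨⟨t0, t1⟩, t2⟩, t3⟩, t4⟩, t5⟩, t6⟩, t7⟩ := ht
    have e1 : t * a * q / (t * mu) = a * q / mu := by
      rw [mul_assoc, mul_div_mul_left _ _ t0]
    have e2 : lam * q / (t * mu) = lam * q / mu / t := by rw [mul_comm t, div_div]
    refine hθ.wpSeries_transformation_of_generic hq (mul_ne_zero t0 ha) (mul_ne_zero t0 hb)
      (mul_ne_zero t0 hc) hd hl hE hF (mul_ne_zero t0 hmu) ?_ ?_ ?_ ?_ ?_ ?_ ?_ ?_ hqN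
      (fun l _ => t1 l) hlN ?_ hBN hCN (sf_ne_zero.2 fun l _ => t3 l) ?_ ?_ ?_
      (sf_ne_zero.2 fun l _ => t6 l) hlE hlF ?_ hlEF
    · linear_combination t ^ 2 * hlam
    · linear_combination t * hB
    · linear_combination t * hC
    · linear_combination t * hD
    · linear_combination t * hb'
    · linear_combination t * hc'
    · rw [mul_left_comm, div_mul_eq_mul_div, mul_div_cancel₀ _ t0, hd']
    · linear_combination t * hbal
    · rw [mul_div_assoc]; exact sf_ne_zero.2 fun l _ => t2 l
    · rw [mul_assoc, mul_div_assoc]; exact sf_ne_zero.2 fun l _ => t4 l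
    · rw [mul_assoc, mul_div_assoc]; exact sf_ne_zero.2 fun l _ => t5 l
    · rw [e1]; exact hmN
    · rw [e2]; exact sf_ne_zero.2 fun l _ => t7 l

end IsTheta

/-! ### Reduction of the multiple series -/

theorem sum_simplex (n N : ℕ) (F : (Fin n → ℕ) → ℂ) :
    ∑ k ∈ simplex n N, F k = ∑ K ∈ range (N + 1), ∑ k ∈ piAntidiag univ K, F k := by
  rw [← sum_fiberwise_of_maps_to (s := simplex n N) (t := range (N + 1)) (g := fun k => ∑ r, k r)
    (fun k hk => mem_range.2 (Nat.lt_succ_of_le (mem_simplex.1 hk)))]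
  refine sum_congr rfl fun K hK => sum_congr ?_ fun _ _ => rfl
  ext k
  simp only [mem_filter, mem_simplex, mem_piAntidiag, mem_univ, implies_true, and_true]
  exact ⟨fun h => h.2, fun h => ⟨h ▸ Nat.lt_succ_iff.1 (mem_range.1 hK), h⟩⟩

theorem thetaPoch_eq_sf (q p a : ℂ) (k : ℕ) : thetaPoch q p a k = sf (fun u => theta u p) q a k :=
  rfl

/-- In a series over the simplex whose terms depend on the total degree only, apart from the type
`A` kernel, the summation of the kernel leaves a series in one variable. -/
theorem sum_simplex_kernel {p q : ℂ} (hp : ‖p‖ < 1) (hq : q ≠ 0) {n N : ℕ} (hn : 0 < n)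
    {x e : Fin n → ℂ} {g : ℂ} (hg : g ≠ 0) (hx : ∀ r, x r ≠ 0) (he : ∀ r, e r ≠ 0)
    (hvand : ∀ r s : Fin n, r < s → theta (x r / x s) p ≠ 0)
    (hden : ∀ r s : Fin n, thetaPoch q p (q * (x r / x s)) N ≠ 0)
    (hgden : ∀ r, thetaPochs q p [g * x r, g * x r / e r] N ≠ 0) (W : ℕ → ℂ) :
    ∑ k ∈ simplex n N, vandermonde q p x k
      * (∏ r, ∏ s, thetaPoch q p (e s * (x r / x s)) (k r) / thetaPoch q p (q * (x r / x s)) (k r))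
      * W (∑ r, k r)
      * (∏ r, thetaPoch q p (g * x r / ∏ i, e i) (k r) * thetaPoch q p (g * x r) (∑ s, k s)
          / (thetaPoch q p (g * x r) (k r) * thetaPoch q p (g * x r / e r) (∑ s, k s)))
      * q ^ (∑ r : Fin n, ((r : ℕ) + 1) * k r) =
    ∑ K ∈ range (N + 1), W K * (thetaPoch q p (∏ i, e i) K / thetaPoch q p q K) * q ^ K := by
  have hθ := isTheta_theta hp
  simp only [thetaPochs, List.map_cons, List.map_nil, List.prod_cons, List.prod_nil, mul_one,
    thetaPoch_eq_sf] at hden hgden ⊢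
  have hqN : sf (fun u => theta u p) q q N ≠ 0 := by
    have := hden ⟨0, hn⟩ ⟨0, hn⟩
    rwa [div_self (hx _), mul_one] at this
  have hne : ∀ r s, r ≠ s → theta (x r / x s) p ≠ 0 := fun r s hrs => by
    rcases lt_or_gt_of_ne hrs with h | h
    · exact hvand r s h
    · intro h0
      refine hvand s r h ?_
      rw [hθ.div_comm (hx s) (hx r)]
      simp only [h0, mul_zero]
  -- the theta functions in the denominators of the partial fractions do not vanish: positive powers
  -- of `q` come from `hden`, negative ones from `hden` with `r` and `s` exchanged
  have hup : ∀ r s, r ≠ s → ∀ i ≤ N, theta (x r / x s * q ^ i) p ≠ 0 := fun r s hrs i hi => by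
    rcases i with _ | i
    · simpa using hne r s hrs
    · have := sf_ne_zero.1 (hden r s) i (by omega)
      convert this using 2
      ring
  have hX : ∀ r s, r ≠ s → ∀ k ≤ N, ∀ l ≤ N, theta (x r * q ^ k / (x s * q ^ l)) p ≠ 0 := by
    intro r s hrs k hk l hl
    have hs := hx s
    have hr := hx r
    rcases le_total l k with h | h
    · obtain ⟨i, rfl⟩ := Nat.exists_eq_add_of_le h
      have := hup r s hrs i (by omega)
      convert this using 2
      rw [pow_add]
      field_simp
    · obtain ⟨i, rfl⟩ := Nat.exists_eq_add_of_le h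
      intro h0
      refine hup s r hrs.symm i (by omega) ?_
      rw [show x s / x r * q ^ i = (x s * q ^ (k + i)) / (x r * q ^ k) by
        rw [pow_add]; field_simp]
      rw [hθ.div_comm (mul_ne_zero hs (pow_ne_zero _ hq)) (mul_ne_zero hr (pow_ne_zero _ hq))]
      simp only [h0, mul_zero]
  rw [sum_simplex]
  refine sum_congr rfl fun K hK => ?_
  have hKN := Nat.lt_succ_iff.1 (mem_range.1 hK)
  have key := hθ.sum_kernelTerm hq hg hx he hX hqN (fun r => left_ne_zero_of_mul (hgden r)) hKN
  have n1 : ∏ r, sf (fun u => theta u p) q (g * x r) K ≠ 0 := prod_ne_zero_iff.2 fun r _ =>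
    sf_ne_zero_of_le (left_ne_zero_of_mul (hgden r)) hKN
  have n2 : ∏ r, sf (fun u => theta u p) q (g * x r / e r) K ≠ 0 := prod_ne_zero_iff.2 fun r _ =>
    sf_ne_zero_of_le (right_ne_zero_of_mul (hgden r)) hKN
  have n3 := sf_ne_zero_of_le hqN hKN
  have e1 : ∀ k ∈ piAntidiag (univ : Finset (Fin n)) K, vandermonde q p x k
      * (∏ r, ∏ s, sf (fun u => theta u p) q (e s * (x r / x s)) (k r) /
          sf (fun u => theta u p) q (q * (x r / x s)) (k r))
      * W (∑ r, k r)
      * (∏ r, sf (fun u => theta u p) q (g * x r / ∏ i, e i) (k r) *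
            sf (fun u => theta u p) q (g * x r) (∑ s, k s)
          / (sf (fun u => theta u p) q (g * x r) (k r) *
            sf (fun u => theta u p) q (g * x r / e r) (∑ s, k s)))
      * q ^ (∑ r : Fin n, ((r : ℕ) + 1) * k r) =
      kernelTerm (fun u => theta u p) q x e g k *
        (W K * ((∏ r, sf (fun u => theta u p) q (g * x r) K) /
          ∏ r, sf (fun u => theta u p) q (g * x r / e r) K)) := fun k hk => by
    rw [(mem_piAntidiag.1 hk).1]
    simp only [kernelTerm, vandermonde, mul_div_mul_comm _ (sf _ _ _ K), prod_mul_distrib]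
    simp only [prod_div_distrib]
    ring
  rw [sum_congr rfl e1, ← sum_mul]
  have aux : ∀ S w A B Q E P : ℂ, A ≠ 0 → B ≠ 0 → Q ≠ 0 → S * (Q * A) = P * E * B →
      S * (w * (A / B)) = w * (E / Q) * P := by
    intro S w A B Q E P hA hB hQ h
    field_simp
    linear_combination w * h
  exact aux _ _ _ _ _ _ _ n1 n2 n3 key

end EllipticSeries

theorem mainTheorem3 (n m N : ℕ) (hn : 0 < n) (hm : 0 < m)
    (p q : ℂ) (hp : ‖p‖ < 1) (hq : q ≠ 0)
    (a b c d g h : ℂ) (ha : a ≠ 0) (hb : b ≠ 0) (hc : c ≠ 0) (hd : d ≠ 0)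
    (hg : g ≠ 0) (hh : h ≠ 0)
    (x e : Fin n → ℂ) (hx : ∀ r, x r ≠ 0) (he : ∀ r, e r ≠ 0)
    (y f : Fin m → ℂ) (hy : ∀ r, y r ≠ 0) (hf : ∀ r, f r ≠ 0)
    (lam E F : ℂ) (hlam : lam = q * a ^ 2 / (b * c * d))
    (hE : E = ∏ r, e r) (hF : F = ∏ r, f r)
    -- the denominators of the sum on the left do not vanish
    (hx_vand : ∀ r s : Fin n, r < s → EllipticSeries.theta (x r / x s) p ≠ 0)
    (hx_den : ∀ r s : Fin n, EllipticSeries.thetaPoch q p (q * (x r / x s)) N ≠ 0)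
    (hg_den : ∀ r, EllipticSeries.thetaPochs q p [g * x r, g * x r / e r] N ≠ 0)
    (ha_theta : EllipticSeries.theta a p ≠ 0)
    (hleft_den : EllipticSeries.thetaPochs q p
      [a * q ^ (N + 1), a * q / b, a * q / c, a * q / d,
        a * q / E, a * q / F, E * F * q ^ (-(N : ℤ)) / lam] N ≠ 0)
    -- the denominators of the prefactor and of the sum on the right do not vanish
    (hpre_den : EllipticSeries.thetaPochs q p
      [a * q / E, a * q / F, lam * q, lam * q / (E * F)] N ≠ 0)
    (hy_vand : ∀ r s : Fin m, r < s → EllipticSeries.theta (y r / y s) p ≠ 0)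
    (hy_den : ∀ r s : Fin m, EllipticSeries.thetaPoch q p (q * (y r / y s)) N ≠ 0)
    (hh_den : ∀ r, EllipticSeries.thetaPochs q p [h * y r, h * y r / f r] N ≠ 0)
    (hlam_theta : EllipticSeries.theta lam p ≠ 0)
    (hright_den : EllipticSeries.thetaPochs q p
      [lam * q ^ (N + 1), a * q / b, a * q / c, a * q / d,
        lam * q / E, lam * q / F, E * F * q ^ (-(N : ℤ)) / a] N ≠ 0) :
    ∑ k ∈ EllipticSeries.simplex n N,
        (EllipticSeries.vandermonde q p x k
          * (∏ r, ∏ s, EllipticSeries.thetaPoch q p (e s * (x r / x s)) (k r)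
              / EllipticSeries.thetaPoch q p (q * (x r / x s)) (k r))
          * (EllipticSeries.theta (a * q ^ (2 * ∑ r, k r)) p / EllipticSeries.theta a p)
          * (EllipticSeries.thetaPochs q p [a, b, c, d] (∑ r, k r)
              / EllipticSeries.thetaPochs q p
                  [a * q ^ (N + 1), a * q / b, a * q / c, a * q / d] (∑ r, k r))
          * (EllipticSeries.thetaPochs q p
                [F, lam * a * q ^ (1 + N) / (E * F), q ^ (-(N : ℤ))] (∑ r, k r)
              / EllipticSeries.thetaPochs q p
                  [a * q / E, a * q / F, E * F * q ^ (-(N : ℤ)) / lam] (∑ r, k r))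
          * (∏ r, EllipticSeries.thetaPoch q p (g * x r / E) (k r)
                * EllipticSeries.thetaPoch q p (g * x r) (∑ s, k s)
              / (EllipticSeries.thetaPoch q p (g * x r) (k r)
                * EllipticSeries.thetaPoch q p (g * x r / e r) (∑ s, k s)))
          * q ^ (∑ r : Fin n, ((r : ℕ) + 1) * k r))
      = EllipticSeries.thetaPochs q p
            [a * q, a * q / (E * F), lam * q / E, lam * q / F] N
          / EllipticSeries.thetaPochs q p
            [a * q / E, a * q / F, lam * q, lam * q / (E * F)] N
        * ∑ j ∈ EllipticSeries.simplex m N,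
        (EllipticSeries.vandermonde q p y j
          * (∏ r, ∏ s, EllipticSeries.thetaPoch q p (f s * (y r / y s)) (j r)
              / EllipticSeries.thetaPoch q p (q * (y r / y s)) (j r))
          * (EllipticSeries.theta (lam * q ^ (2 * ∑ r, j r)) p / EllipticSeries.theta lam p)
          * (EllipticSeries.thetaPochs q p
                [lam, lam * b / a, lam * c / a, lam * d / a] (∑ r, j r)
              / EllipticSeries.thetaPochs q p
                  [lam * q ^ (N + 1), a * q / b, a * q / c, a * q / d] (∑ r, j r))
          * (EllipticSeries.thetaPochs q p
                [E, lam * a * q ^ (1 + N) / (E * F), q ^ (-(N : ℤ))] (∑ r, j r)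
              / EllipticSeries.thetaPochs q p
                  [lam * q / E, lam * q / F, E * F * q ^ (-(N : ℤ)) / a] (∑ r, j r))
          * (∏ r, EllipticSeries.thetaPoch q p (h * y r / F) (j r)
                * EllipticSeries.thetaPoch q p (h * y r) (∑ s, j s)
              / (EllipticSeries.thetaPoch q p (h * y r) (j r)
                * EllipticSeries.thetaPoch q p (h * y r / f r) (∑ s, j s)))
          * q ^ (∑ r : Fin m, ((r : ℕ) + 1) * j r)) := by
  subst hE hF
  have hθ := EllipticSeries.isTheta_theta hp
  have hE0 : ∏ r, e r ≠ 0 := prod_ne_zero_iff.2 fun r _ => he r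
  have hF0 : ∏ r, f r ≠ 0 := prod_ne_zero_iff.2 fun r _ => hf r
  have hl : lam ≠ 0 := by rw [hlam]; positivity
  have hlam' : lam * (b * c * d) = q * a ^ 2 := by rw [hlam]; field_simp
  have hqN : EllipticSeries.thetaPoch q p q N ≠ 0 := by
    have := hx_den ⟨0, hn⟩ ⟨0, hn⟩
    rwa [div_self (hx _), mul_one] at this
  -- both multiple series collapse to series in one variable
  have hL := EllipticSeries.sum_simplex_kernel hp hq hn hg hx he hx_vand hx_den hg_den (fun K =>
    EllipticSeries.theta (a * q ^ (2 * K)) p / EllipticSeries.theta a p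
      * (EllipticSeries.thetaPochs q p [a, b, c, d] K / EllipticSeries.thetaPochs q p
        [a * q ^ (N + 1), a * q / b, a * q / c, a * q / d] K)
      * (EllipticSeries.thetaPochs q p
          [∏ r, f r, lam * a * q ^ (1 + N) / ((∏ r, e r) * ∏ r, f r), q ^ (-(N : ℤ))] K
        / EllipticSeries.thetaPochs q p [a * q / ∏ r, e r, a * q / ∏ r, f r,
          (∏ r, e r) * (∏ r, f r) * q ^ (-(N : ℤ)) / lam] K))
  have hR := EllipticSeries.sum_simplex_kernel hp hq hm hh hy hf hy_vand hy_den hh_den (fun K =>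
    EllipticSeries.theta (lam * q ^ (2 * K)) p / EllipticSeries.theta lam p
      * (EllipticSeries.thetaPochs q p [lam, lam * b / a, lam * c / a, lam * d / a] K
        / EllipticSeries.thetaPochs q p
        [lam * q ^ (N + 1), a * q / b, a * q / c, a * q / d] K)
      * (EllipticSeries.thetaPochs q p
          [∏ r, e r, lam * a * q ^ (1 + N) / ((∏ r, e r) * ∏ r, f r), q ^ (-(N : ℤ))] K
        / EllipticSeries.thetaPochs q p [lam * q / ∏ r, e r, lam * q / ∏ r, f r,
          (∏ r, e r) * (∏ r, f r) * q ^ (-(N : ℤ)) / a] K))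
  simp only [mul_assoc] at hL hR ⊢
  rw [hL, hR]
  clear hL hR hx_vand hx_den hg_den hy_vand hy_den hh_den
  simp only [← mul_assoc]
  generalize ∏ r, e r = E at *
  generalize ∏ r, f r = F at *
  have hz : q ^ (-(N : ℤ)) = (q ^ N)⁻¹ := by rw [zpow_neg, zpow_natCast]
  have hqN0 : q ^ N ≠ 0 := pow_ne_zero _ hq
  have m1 : E * F * (q ^ N)⁻¹ / lam = a * q / (lam * a * q ^ (N + 1) / (E * F)) := by
    field_simp
    ring
  have m2 : E * F * (q ^ N)⁻¹ / a = lam * q / (lam * a * q ^ (N + 1) / (E * F)) := by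
    field_simp
    ring
  simp only [EllipticSeries.thetaPochs, List.map_cons, List.map_nil, List.prod_cons, List.prod_nil,
    mul_one, EllipticSeries.thetaPoch_eq_sf, hz, m1, m2, add_comm 1 N, mul_ne_zero_iff]
    at hleft_den hpre_den hright_den hqN ⊢
  obtain ⟨p1, p2, p3, p4⟩ := hpre_den
  obtain ⟨l1, l2, l3, l4, -, -, l5⟩ := hleft_den
  obtain ⟨r1, -, -, -, r2, r3, r4⟩ := hright_den
  have hT := hθ.wpSeries_transformation hq ha hb hc hd hl hE0 hF0
    (mu := lam * a * q ^ (N + 1) / (E * F)) (by positivity) hlam'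
    (div_mul_cancel₀ (a * q) hb) (div_mul_cancel₀ (a * q) hc) (div_mul_cancel₀ (a * q) hd)
    (div_mul_cancel₀ (lam * b) ha) (div_mul_cancel₀ (lam * c) ha) (div_mul_cancel₀ (lam * d) ha)
    (div_mul_cancel₀ _ (mul_ne_zero hE0 hF0)) hqN ha_theta l1 (fun l hl' => ?_) l2 l3 l4 p1 p2 l5
    r2 r3 r4 p4
  · refine Eq.trans (sum_congr rfl fun k _ => ?_) (hT.trans (congrArg₂ (· * ·) ?_
      (sum_congr rfl fun k _ => ?_)))
    · ring
    · unfold EllipticSeries.wpFactor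
      ring
    · ring
  · rcases Nat.eq_zero_or_pos l with rfl | h0
    · simpa using hlam_theta
    · rcases le_or_gt l N with h | h
      · have := EllipticSeries.sf_ne_zero.1 p3 (l - 1) (by omega)
        rwa [mul_assoc, ← pow_succ', Nat.sub_add_cancel h0] at this
      · have := EllipticSeries.sf_ne_zero.1 r1 (l - (N + 1)) (by omega)
        rwa [mul_assoc, ← pow_add, Nat.add_sub_cancel' h] at this
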